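/- Conventions. $\mathcal N$ is a smooth $\mathfrak n$-dimensional manifold without boundary. Hypersurface data $\{\mathcal N,\gamma,\boldsymbol\ell,\ell^{(2)},\mathbf Y\}$ consist of smooth fields on $\mathcal N$: symmetric 2-covariant tensors $\gamma$ and $\mathbf Y$, a covector $\boldsymbol\ell$ and a scalar $\ell^{(2)}$, such that at every point the symmetric bilinear form $\boldsymbol{\mathcal A}((W,a),(Z,b))=\gamma(W,Z)+a\,\boldsymbol\ell(Z)+b\,\boldsymbol\ell(W)+ab\,\ell^{(2)}$ on $T_p\mathcal N\times\mathbb R$ is non-degenerate. Its inverse on $T_p^\star\mathcal N\times\mathbb R$ is written $P(\boldsymbol\alpha,\boldsymbol\beta)+a\,n(\boldsymbol\beta)+b\,n(\boldsymbol\alpha)+ab\,n^{(2)}$, which defines $P^{ab}$, $n^a$, $n^{(2)}$. Put $\mathbf F=\tfrac12 d\boldsymbol\ell$, $\boldsymbol s=\mathbf F(n,\cdot)$, $\mathbf U=\tfrac12\pounds_n\gamma+\tfrac12(\boldsymbol\ell\otimes dn^{(2)}+dn^{(2)}\otimes\boldsymbol\ell)$, $\boldsymbol r=\mathbf Y(n,\cdot)$,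 $\kappa_n=-\mathbf Y(n,n)$, $\mathrm{tr}_P T=P^{ab}T_{ab}$. Let $\overset{\circ}{\nabla}$ be the unique torsion-free connection with $\overset{\circ}{\nabla}_a\gamma_{bc}=-\mathrm U_{ab}\ell_c-\mathrm U_{ac}\ell_b$ and $\overset{\circ}{\nabla}_a\ell_b+\overset{\circ}{\nabla}_b\ell_a=-2\ell^{(2)}\mathrm U_{ab}$; $\overset{\circ}{R}{}^a{}_{bcd}$ are the components of its curvature, $R(X,W)Z=(\overset{\circ}{\nabla}_X\overset{\circ}{\nabla}_W-\overset{\circ}{\nabla}_W\overset{\circ}{\nabla}_X-\overset{\circ}{\nabla}_{[X,W]})Z$ having components $\overset{\circ}{R}{}^a{}_{bcd}Z^bX^cW^d$, and $\overset{\circ}{R}_{bd}=\overset{\circ}{R}{}^a{}_{bad}$. Round (square) brackets denote symmetrization (antisymmetrization) with factor $\tfrac12$. Define \begin{align*} A_{bcd}&=\ell_a\overset{\circ}{R}{}^a{}_{bcd}+2\overset{\circ}{\nabla}_{[d}\mathrm Y_{c]b}+2\ell^{(2)}\overset{\circ}{\nabla}_{[d}\mathrm U_{c]b}+\mathrm U_{b[c}\overset{\circ}{\nabla}_{d]}\ell^{(2)}+\mathrm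 Y_{b[d}\big(2(\mathrm F_{c]f}+\mathrm Y_{c]f})n^f+n^{(2)}\overset{\circ}{\nabla}_{c]}\ell^{(2)}\big),\\ B_{abcd}&=\gamma_{af}\overset{\circ}{R}{}^f{}_{bcd}+2\ell_a\overset{\circ}{\nabla}_{[d}\mathrm U_{c]b}+2\mathrm Y_{b[c}\mathrm U_{d]a}+2\mathrm U_{b[c}(\mathrm Y_{d]a}+\mathrm F_{d]a})+2n^{(2)}\mathrm Y_{b[c}\mathrm Y_{d]a}. \end{align*} Proposition. For every hypersurface data set the following identities hold: \begin{align*} P^{ac}B_{abcd}={}&\overset{\circ}{R}_{(bd)}-\overset{\circ}{\nabla}_{(b}s_{d)}+s_bs_d-\mathrm U_{bd}\,n(\ell^{(2)})+\Big(-2n^{(2)}s_{(b}+\tfrac12\overset{\circ}{\nabla}_{(b}n^{(2)}+\tfrac12(n^{(2)})^2\overset{\circ}{\nabla}_{(b}\ell^{(2)}\Big)\overset{\circ}{\nabla}_{d)}\ell^{(2)}\\ &+P^{ac}\Big(n^{(2)}\mathrm F_{ba}\mathrm F_{dc}+\mathrm U_{ba}\mathrm Y_{dc}+\mathrm U_{da}\mathrm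 Y_{bc}-\mathrm U_{bd}\mathrm Y_{ac}-\mathrm Y_{bd}\mathrm U_{ac}+n^{(2)}\mathrm Y_{ba}\mathrm Y_{dc}-n^{(2)}\mathrm Y_{bd}\mathrm Y_{ac}\Big),\\ n^c(A_{bcd}+A_{dcb})={}&-2\pounds_n\mathrm Y_{bd}+2\overset{\circ}{\nabla}_{(b}(s_{d)}+r_{d)})-2\kappa_n\mathrm Y_{bd}-2(r_b-s_b)(r_d-s_d)\\ &+\Big(3n^{(2)}s_{(b}-3n^{(2)}r_{(b}-\tfrac12\overset{\circ}{\nabla}_{(b}n^{(2)}-\tfrac12(n^{(2)})^2\overset{\circ}{\nabla}_{(b}\ell^{(2)}\Big)\overset{\circ}{\nabla}_{d)}\ell^{(2)}\\ &+(\mathrm U_{bd}+n^{(2)}\mathrm Y_{bd})\,n(\ell^{(2)})+2P^{ac}(\mathrm Y_{c(b}-\mathrm F_{c(b})(\mathrm U_{d)a}-n^{(2)}\mathrm F_{d)a}). \end{align*} Moreover $n^c(A_{bcd}+A_{dcb})+P^{ac}B_{abcd}=\mathcal R_{bd}$, where $\mathcal R$ is the constraint tensor \begin{align*} \mathcal R_{bd}={}&\overset{\circ}{R}_{(bd)}-2\pounds_n\mathrm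 Y_{bd}-\big(2\kappa_n+\mathrm{tr}_P\mathbf U-n^{(2)}(n(\ell^{(2)})-\mathrm{tr}_P\mathbf Y)\big)\mathrm Y_{bd}+\overset{\circ}{\nabla}_{(b}(s_{d)}+2r_{d)})-2r_br_d+4r_{(b}s_{d)}-s_bs_d\\ &-(\mathrm{tr}_P\mathbf Y)\mathrm U_{bd}+2P^{ac}\mathrm U_{a(b}(2\mathrm Y_{d)c}+\mathrm F_{d)c})\\ &+n^{(2)}\Big((s_{(b}-3r_{(b})\overset{\circ}{\nabla}_{d)}\ell^{(2)}+P^{ac}\big((\mathrm Y_{ab}+\mathrm F_{ab})(\mathrm Y_{cd}+\mathrm F_{cd})-2\mathrm F_{ab}\mathrm F_{cd}\big)\Big). \end{align*} -/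

import Mathlib

open Bundle
open scoped Manifold ContDiff

set_option linter.unusedSectionVars false

noncomputable section

/-- The bilinear form `𝓐((W,a),(Z,b)) = γ(W,Z) + a ℓ(Z) + b ℓ(W) + a b ℓ₂` on `V × ℝ`. -/
def ambientForm {V : Type*} [AddCommGroup V] [Module ℝ V] [TopologicalSpace V]
    (g : V →L[ℝ] V →L[ℝ] ℝ) (l : V →L[ℝ] ℝ) (c : ℝ) : LinearMap.BilinForm ℝ (V × ℝ) :=
  LinearMap.mk₂ ℝ
    (fun u v => g u.1 v.1 + u.2 * l v.1 + v.2 * l u.1 + u.2 * v.2 * c)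
    (by intro u u' v; simp; ring)
    (by intro k u v; simp; ring)
    (by intro u v v'; simp; ring)
    (by intro k u v; simp; ring)

/-- Metric hypersurface data `{N, γ, ℓ, ℓ₂}` on a smooth `m`-dimensional manifold without boundary:
a smooth symmetric 2-covariant tensor field `γ`, a smooth covector field `ℓ` and a smooth scalar
`ℓ₂` such that the form `𝓐` is nondegenerate at every point. -/
structure MetricHypersurfaceData (m : ℕ) (N : Type*) [TopologicalSpace N]
    [ChartedSpace (EuclideanSpace ℝ (Fin m)) N] [IsManifold (𝓡 m) ∞ N] where
  γ : ∀ p : N, TangentSpace (𝓡 m) p →L[ℝ] TangentSpace (𝓡 m) p →L[ℝ] ℝ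
  ell : ∀ p : N, TangentSpace (𝓡 m) p →L[ℝ] ℝ
  ell2 : N → ℝ
  γ_symm : ∀ (p : N) (v w : TangentSpace (𝓡 m) p), γ p v w = γ p w v
  γ_smooth : ContMDiff (𝓡 m)
    ((𝓡 m).prod 𝓘(ℝ, EuclideanSpace ℝ (Fin m) →L[ℝ] EuclideanSpace ℝ (Fin m) →L[ℝ] ℝ)) ∞
    (fun p => TotalSpace.mk'
      (EuclideanSpace ℝ (Fin m) →L[ℝ] EuclideanSpace ℝ (Fin m) →L[ℝ] ℝ)
      (E := fun p : N => TangentSpace (𝓡 m) p →L[ℝ] TangentSpace (𝓡 m) p →L[ℝ] ℝ) p (γ p))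
  ell_smooth : ContMDiff (𝓡 m) ((𝓡 m).prod 𝓘(ℝ, EuclideanSpace ℝ (Fin m) →L[ℝ] ℝ)) ∞
    (fun p => TotalSpace.mk' (EuclideanSpace ℝ (Fin m) →L[ℝ] ℝ)
      (E := fun p : N => TangentSpace (𝓡 m) p →L[ℝ] ℝ) p (ell p))
  ell2_smooth : ContMDiff (𝓡 m) 𝓘(ℝ, ℝ) ∞ ell2
  nondegenerate : ∀ p : N, (ambientForm (γ p) (ell p) (ell2 p)).Nondegenerate

/-- Hypersurface data `{N, γ, ℓ, ℓ₂, Y}`: metric hypersurface data together with an additional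
smooth symmetric 2-covariant tensor field `Y`. -/
structure HypersurfaceData (m : ℕ) (N : Type*) [TopologicalSpace N]
    [ChartedSpace (EuclideanSpace ℝ (Fin m)) N] [IsManifold (𝓡 m) ∞ N]
    extends MetricHypersurfaceData m N where
  Y : ∀ p : N, TangentSpace (𝓡 m) p →L[ℝ] TangentSpace (𝓡 m) p →L[ℝ] ℝ
  Y_symm : ∀ (p : N) (v w : TangentSpace (𝓡 m) p), Y p v w = Y p w v
  Y_smooth : ContMDiff (𝓡 m)
    ((𝓡 m).prod 𝓘(ℝ, EuclideanSpace ℝ (Fin m) →L[ℝ] EuclideanSpace ℝ (Fin m) →L[ℝ] ℝ)) ∞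
    (fun p => TotalSpace.mk'
      (EuclideanSpace ℝ (Fin m) →L[ℝ] EuclideanSpace ℝ (Fin m) →L[ℝ] ℝ)
      (E := fun p : N => TangentSpace (𝓡 m) p →L[ℝ] TangentSpace (𝓡 m) p →L[ℝ] ℝ) p (Y p))

/-! ### Tensor calculus in coordinates

Tensor fields on an open subset of `ℝᵐ` are given by their component functions. -/

namespace CoordCalc

variable {m : ℕ}

/-- `T_(bd) = (T_bd + T_db) / 2`. -/
def symPart (T : Fin m → Fin m → ℝ) (b d : Fin m) : ℝ := (T b d + T d b) / 2

/-- `T_[bd] = (T_bd - T_db) / 2`. -/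
def altPart (T : Fin m → Fin m → ℝ) (b d : Fin m) : ℝ := (T b d - T d b) / 2

/-- The partial derivative `∂_a f`. -/
def pd (a : Fin m) (f : EuclideanSpace ℝ (Fin m) → ℝ) (x : EuclideanSpace ℝ (Fin m)) : ℝ :=
  fderiv ℝ f x (EuclideanSpace.single a 1)

/-- `∇_a θ_b` for a covector `θ`, where `Γ c a b` is the connection coefficient `Γ^c_ab`, i.e.
`∇_{∂_a} ∂_b = Γ^c_ab ∂_c`. -/
def covD₁ (Γ : Fin m → Fin m → Fin m → EuclideanSpace ℝ (Fin m) → ℝ)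
    (θ : Fin m → EuclideanSpace ℝ (Fin m) → ℝ) (a b : Fin m) (x : EuclideanSpace ℝ (Fin m)) : ℝ :=
  pd a (θ b) x - ∑ c, Γ c a b x * θ c x

/-- `∇_a T_bc` for a 2-covariant tensor `T`. -/
def covD₂ (Γ : Fin m → Fin m → Fin m → EuclideanSpace ℝ (Fin m) → ℝ)
    (T : Fin m → Fin m → EuclideanSpace ℝ (Fin m) → ℝ) (a b c : Fin m)
    (x : EuclideanSpace ℝ (Fin m)) : ℝ :=
  pd a (T b c) x - ∑ f, Γ f a b x * T f c x - ∑ f, Γ f a c x * T b f x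

/-- The curvature tensor `R^a_bcd = dx^a (R(∂_c, ∂_d) ∂_b)` where
`R(X,W) = ∇_X ∇_W - ∇_W ∇_X - ∇_[X,W]`. -/
def curvature (Γ : Fin m → Fin m → Fin m → EuclideanSpace ℝ (Fin m) → ℝ) (a b c d : Fin m)
    (x : EuclideanSpace ℝ (Fin m)) : ℝ :=
  pd c (Γ a d b) x - pd d (Γ a c b) x
    + ∑ f, Γ a c f x * Γ f d b x - ∑ f, Γ a d f x * Γ f c b x

/-- The Ricci tensor `R_bd = R^a_bad`. -/
def ricci (Γ : Fin m → Fin m → Fin m → EuclideanSpace ℝ (Fin m) → ℝ) (b d : Fin m)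
    (x : EuclideanSpace ℝ (Fin m)) : ℝ :=
  ∑ a, curvature Γ a b a d x

/-- The derivative `v(f) = v^a ∂_a f` of a function along a vector field. -/
def vecD (v : Fin m → EuclideanSpace ℝ (Fin m) → ℝ) (f : EuclideanSpace ℝ (Fin m) → ℝ)
    (x : EuclideanSpace ℝ (Fin m)) : ℝ :=
  ∑ a, v a x * pd a f x

/-- The Lie derivative `(£_v T)_bd = v^c ∂_c T_bd + T_cd ∂_b v^c + T_bc ∂_d v^c`. -/
def lieD (v : Fin m → EuclideanSpace ℝ (Fin m) → ℝ)
    (T : Fin m → Fin m → EuclideanSpace ℝ (Fin m) → ℝ) (b d : Fin m)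
    (x : EuclideanSpace ℝ (Fin m)) : ℝ :=
  vecD v (T b d) x + ∑ c, T c d x * pd b (v c) x + ∑ c, T b c x * pd d (v c) x

end CoordCalc

open CoordCalc

section Coordinates

variable {m : ℕ} {N : Type*} [TopologicalSpace N] [ChartedSpace (EuclideanSpace ℝ (Fin m)) N]

/-- The coordinate vector `∂_a` of the chart `e` at the point with coordinates `x`. -/
def coordVec (e : OpenPartialHomeomorph N (EuclideanSpace ℝ (Fin m))) (a : Fin m)
    (x : EuclideanSpace ℝ (Fin m)) : TangentSpace (𝓡 m) (e.symm x) :=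
  mfderiv (𝓡 m) (𝓡 m) e.symm x (EuclideanSpace.single a (1 : ℝ) : EuclideanSpace ℝ (Fin m))

/-- The coordinate covector `dx^a` of the chart `e` at the point with coordinates `x`. -/
def coordCovec (e : OpenPartialHomeomorph N (EuclideanSpace ℝ (Fin m))) (a : Fin m)
    (x : EuclideanSpace ℝ (Fin m)) : Module.Dual ℝ (TangentSpace (𝓡 m) (e.symm x)) :=
  (EuclideanSpace.proj a : EuclideanSpace ℝ (Fin m) →L[ℝ] ℝ).toLinearMap ∘ₗ
    (mfderiv (𝓡 m) (𝓡 m) e (e.symm x)).toLinearMap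

variable {e : OpenPartialHomeomorph N (EuclideanSpace ℝ (Fin m))} {x : EuclideanSpace ℝ (Fin m)}

theorem mdiff_symm (he : e ∈ IsManifold.maximalAtlas (𝓡 m) ∞ N) (hx : x ∈ e.target) :
    MDifferentiableAt (𝓡 m) (𝓡 m) e.symm x :=
  (contMDiffAt_symm_of_mem_maximalAtlas he hx).mdifferentiableAt (by simp)

theorem mdiff_chart (he : e ∈ IsManifold.maximalAtlas (𝓡 m) ∞ N) (hx : x ∈ e.target) :
    MDifferentiableAt (𝓡 m) (𝓡 m) e (e.symm x) :=
  (contMDiffAt_of_mem_maximalAtlas he (e.map_target hx)).mdifferentiableAt (by simp)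

theorem differentiableAt_of_contDiffOn {f : EuclideanSpace ℝ (Fin m) → ℝ}
    (hf : ContDiffOn ℝ ∞ f e.target) (hx : x ∈ e.target) : DifferentiableAt ℝ f x :=
  (hf.contDiffAt (e.open_target.mem_nhds hx)).differentiableAt (by simp)

end Coordinates

namespace MetricHypersurfaceData

variable {m : ℕ} {N : Type*} [TopologicalSpace N] [ChartedSpace (EuclideanSpace ℝ (Fin m)) N]
  [IsManifold (𝓡 m) ∞ N] (D : MetricHypersurfaceData m N)

instance finiteDimensional_tangentSpace (p : N) : FiniteDimensional ℝ (TangentSpace (𝓡 m) p) :=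
  inferInstanceAs (FiniteDimensional ℝ (EuclideanSpace ℝ (Fin m)))

/-- The musical isomorphism `T*_pN × ℝ → T_pN × ℝ` inverse to `𝓐`. -/
def sharp (p : N) (φ : Module.Dual ℝ (TangentSpace (𝓡 m) p) × ℝ) : TangentSpace (𝓡 m) p × ℝ :=
  ((ambientForm (D.γ p) (D.ell p) (D.ell2 p)).toDual (D.nondegenerate p)).symm
    (φ.1.coprod (φ.2 • LinearMap.id))

/-- The contravariant tensor on `T*_pN × ℝ` inverse to `𝓐`. -/
def inverseForm (p : N) (φ ψ : Module.Dual ℝ (TangentSpace (𝓡 m) p) × ℝ) : ℝ :=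
  φ.1 (D.sharp p ψ).1 + φ.2 * (D.sharp p ψ).2

/-- The symmetric 2-contravariant tensor `P`. -/
def P (p : N) (α β : Module.Dual ℝ (TangentSpace (𝓡 m) p)) : ℝ :=
  D.inverseForm p (α, 0) (β, 0)

/-- The vector field `n`, the vector representing `α ↦ 𝓐((α,0),(0,1))`. -/
def n (p : N) : TangentSpace (𝓡 m) p := (D.sharp p (0, 1)).1

/-- The scalar `n₂`. -/
def n2 (p : N) : ℝ := D.inverseForm p (0, 1) (0, 1)

/-! ### Components in a chart

In all that follows `e` is a chart and functions depend on the coordinates `x ∈ e.target`. -/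

variable (e : OpenPartialHomeomorph N (EuclideanSpace ℝ (Fin m)))

/-- `γ_ab` -/
def γC (a b : Fin m) (x : EuclideanSpace ℝ (Fin m)) : ℝ :=
  D.γ (e.symm x) (coordVec e a x) (coordVec e b x)

/-- `ℓ_a` -/
def ellC (a : Fin m) (x : EuclideanSpace ℝ (Fin m)) : ℝ := D.ell (e.symm x) (coordVec e a x)

/-- `ℓ₂` -/
def ell2C (x : EuclideanSpace ℝ (Fin m)) : ℝ := D.ell2 (e.symm x)

/-- `P^ab` -/
def PC (a b : Fin m) (x : EuclideanSpace ℝ (Fin m)) : ℝ :=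
  D.P (e.symm x) (coordCovec e a x) (coordCovec e b x)

/-- `n^a` -/
def nC (a : Fin m) (x : EuclideanSpace ℝ (Fin m)) : ℝ := coordCovec e a x (D.n (e.symm x))

/-- `n₂` -/
def n2C (x : EuclideanSpace ℝ (Fin m)) : ℝ := D.n2 (e.symm x)

/-- `F = (1/2) dℓ`, i.e. `F_ab = (1/2) (∂_a ℓ_b - ∂_b ℓ_a)`. -/
def FC (a b : Fin m) (x : EuclideanSpace ℝ (Fin m)) : ℝ :=
  (pd a (D.ellC e b) x - pd b (D.ellC e a) x) / 2

/-- `s = F(n, ·)` -/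
def sC (b : Fin m) (x : EuclideanSpace ℝ (Fin m)) : ℝ := ∑ a, D.nC e a x * D.FC e a b x

/-- `U = (1/2) £_n γ + ℓ ⊗ₛ d n₂` -/
def UC (a b : Fin m) (x : EuclideanSpace ℝ (Fin m)) : ℝ :=
  lieD (D.nC e) (D.γC e) a b x / 2
    + symPart (fun a b => D.ellC e a x * pd b (D.n2C e) x) a b

/-- The coefficients `Γ^c_ab` of the metric hypersurface connection, the unique torsion-free
connection with `∇_a γ_bc = - U_ab ℓ_c - U_ac ℓ_b` and `∇_a ℓ_b + ∇_b ℓ_a = - 2 ℓ₂ U_ab`;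
this characterization is proved below. -/
def Γ (c a b : Fin m) (x : EuclideanSpace ℝ (Fin m)) : ℝ :=
  (∑ d, D.PC e c d x *
      (pd a (D.γC e b d) x + pd b (D.γC e a d) x - pd d (D.γC e a b) x)) / 2
    + D.nC e c x * (pd a (D.ellC e b) x + pd b (D.ellC e a) x) / 2

end MetricHypersurfaceData

namespace MetricHypersurfaceData

variable {m : ℕ} {N : Type*} [TopologicalSpace N] [ChartedSpace (EuclideanSpace ℝ (Fin m)) N]
  [IsManifold (𝓡 m) ∞ N] (D : MetricHypersurfaceData m N)

theorem sharp_spec (p : N) (φ : Module.Dual ℝ (TangentSpace (𝓡 m) p) × ℝ)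
    (Z : TangentSpace (𝓡 m) p) (b : ℝ) :
    D.γ p (D.sharp p φ).1 Z + (D.sharp p φ).2 * D.ell p Z + b * D.ell p (D.sharp p φ).1
      + (D.sharp p φ).2 * b * D.ell2 p = φ.1 Z + φ.2 * b := by
  have := LinearMap.BilinForm.apply_toDual_symm_apply (hB := D.nondegenerate p)
    (φ.1.coprod (φ.2 • LinearMap.id)) (Z, b)
  exact this

theorem sharp_unique (p : N) (φ : Module.Dual ℝ (TangentSpace (𝓡 m) p) × ℝ)
    (u : TangentSpace (𝓡 m) p × ℝ)
    (h : ∀ Z b, D.γ p u.1 Z + u.2 * D.ell p Z + b * D.ell p u.1 + u.2 * b * D.ell2 p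
      = φ.1 Z + φ.2 * b) : D.sharp p φ = u := by
  unfold sharp
  rw [LinearEquiv.symm_apply_eq]
  ext v
  · have := h v 0
    simpa [LinearMap.BilinForm.toDual_def, ambientForm] using this.symm
  · have := h 0 1
    simpa [LinearMap.BilinForm.toDual_def, ambientForm] using this.symm

theorem sharp_add (p : N) (φ ψ : Module.Dual ℝ (TangentSpace (𝓡 m) p) × ℝ) :
    D.sharp p (φ + ψ) = D.sharp p φ + D.sharp p ψ := by
  apply D.sharp_unique
  intro Z b
  have h1 := D.sharp_spec p φ Z b
  have h2 := D.sharp_spec p ψ Z b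
  simp only [Prod.fst_add, Prod.snd_add, map_add, add_apply,
    LinearMap.add_apply]
  linarith

theorem sharp_smul (p : N) (c : ℝ) (φ : Module.Dual ℝ (TangentSpace (𝓡 m) p) × ℝ) :
    D.sharp p (c • φ) = c • D.sharp p φ := by
  apply D.sharp_unique
  intro Z b
  have h1 := D.sharp_spec p φ Z b
  simp only [Prod.smul_fst, Prod.smul_snd, map_smul, smul_apply,
    LinearMap.smul_apply, smul_eq_mul]
  linear_combination c * h1

theorem n2_eq (p : N) : D.n2 p = (D.sharp p (0, 1)).2 := by
  simp [n2, inverseForm]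

theorem γ_n (p : N) (Z : TangentSpace (𝓡 m) p) : D.γ p (D.n p) Z + D.n2 p * D.ell p Z = 0 := by
  have := D.sharp_spec p (0, 1) Z 0
  rw [n2_eq]
  simpa [n] using this

theorem ell_n (p : N) : D.ell p (D.n p) + D.n2 p * D.ell2 p = 1 := by
  have := D.sharp_spec p (0, 1) 0 1
  rw [n2_eq]
  simpa [n] using this

theorem P_eq (p : N) (α β : Module.Dual ℝ (TangentSpace (𝓡 m) p)) :
    D.P p α β = α (D.sharp p (β, 0)).1 := by
  simp [P, inverseForm]

theorem P_ell (p : N) (α : Module.Dual ℝ (TangentSpace (𝓡 m) p)) :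
    D.P p α (D.ell p).toLinearMap + D.ell2 p * α (D.n p) = 0 := by
  have h1 : D.sharp p ((D.ell p).toLinearMap, D.ell2 p) = (0, 1) := by
    apply D.sharp_unique
    intro Z b
    simp
    ring
  have h2 : (((D.ell p).toLinearMap, D.ell2 p) : Module.Dual ℝ (TangentSpace (𝓡 m) p) × ℝ)
      = ((D.ell p).toLinearMap, 0) + D.ell2 p • (0, 1) := by simp
  rw [h2, sharp_add, sharp_smul] at h1
  have h3 := congrArg (fun v => α v.1) h1
  simpa [P_eq, n] using h3

theorem P_γ (p : N) (α : Module.Dual ℝ (TangentSpace (𝓡 m) p)) (Z : TangentSpace (𝓡 m) p) :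
    D.P p α (D.γ p Z).toLinearMap + D.ell p Z * α (D.n p) = α Z := by
  have h1 : D.sharp p ((D.γ p Z).toLinearMap, D.ell p Z) = (Z, 0) := by
    apply D.sharp_unique
    intro W b
    simp
    ring
  have h2 : (((D.γ p Z).toLinearMap, D.ell p Z) : Module.Dual ℝ (TangentSpace (𝓡 m) p) × ℝ)
      = ((D.γ p Z).toLinearMap, 0) + D.ell p Z • (0, 1) := by simp
  rw [h2, sharp_add, sharp_smul] at h1
  have h3 := congrArg (fun v => α v.1) h1
  simpa [P_eq, n] using h3

theorem P_sum (p : N) (α : Module.Dual ℝ (TangentSpace (𝓡 m) p)) {ι : Type*} (s : Finset ι)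
    (c : ι → ℝ) (β : ι → Module.Dual ℝ (TangentSpace (𝓡 m) p)) :
    D.P p α (∑ i ∈ s, c i • β i) = ∑ i ∈ s, c i * D.P p α (β i) := by
  classical
  induction s using Finset.induction_on with
  | empty =>
    have := D.sharp_smul p 0 (0, 0)
    simp only [zero_smul] at this
    simp only [Finset.sum_empty, P_eq]
    change α (D.sharp p 0).1 = 0
    rw [this]; simp
  | insert i s hi ih =>
    rw [Finset.sum_insert hi, Finset.sum_insert hi, ← ih]
    have h2 : ((c i • β i + ∑ j ∈ s, c j • β j, 0) : Module.Dual ℝ (TangentSpace (𝓡 m) p) × ℝ)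
      = c i • (β i, 0) + (∑ j ∈ s, c j • β j, 0) := by simp
    rw [P_eq, h2, sharp_add, sharp_smul]
    simp [P_eq]

section chart

variable {e : OpenPartialHomeomorph N (EuclideanSpace ℝ (Fin m))} {x : EuclideanSpace ℝ (Fin m)}

theorem coordCovec_coordVec (he : e ∈ IsManifold.maximalAtlas (𝓡 m) ∞ N) (hx : x ∈ e.target)
    (a b : Fin m) : coordCovec e a x (coordVec e b x) = if a = b then 1 else 0 := by
  have h := mfderiv_comp x (mdiff_chart he hx) (mdiff_symm he hx)
  have h2 : mfderiv (𝓡 m) (𝓡 m) (e ∘ e.symm) x = ContinuousLinearMap.id ℝ _ := by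
    rw [← mfderiv_id]
    apply Filter.EventuallyEq.mfderiv_eq
    filter_upwards [e.open_target.mem_nhds hx] with y hy
    exact e.right_inv hy
  have h3 := congrArg (fun L => (L (EuclideanSpace.single b (1 : ℝ) : EuclideanSpace ℝ (Fin m)))) (h.symm.trans h2)
  have h4 := congrArg (fun v : EuclideanSpace ℝ (Fin m) => v a) h3
  simp only [coordCovec, coordVec]
  refine h4.trans ?_
  change (EuclideanSpace.single b (1 : ℝ) : EuclideanSpace ℝ (Fin m)) a = _
  simp [PiLp.single_apply]

theorem sum_coordVec (he : e ∈ IsManifold.maximalAtlas (𝓡 m) ∞ N) (hx : x ∈ e.target)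
    (v : TangentSpace (𝓡 m) (e.symm x)) : ∑ a, coordCovec e a x v • coordVec e a x = v := by
  let L : Module.End ℝ (EuclideanSpace ℝ (Fin m)) :=
    (mfderiv (𝓡 m) (𝓡 m) e.symm x).toLinearMap
  let M : Module.End ℝ (EuclideanSpace ℝ (Fin m)) :=
    (mfderiv (𝓡 m) (𝓡 m) e (e.symm x)).toLinearMap
  let w : EuclideanSpace ℝ (Fin m) := v
  have key : ∀ u : EuclideanSpace ℝ (Fin m),
      (∑ a, u a • (EuclideanSpace.single a (1 : ℝ) : EuclideanSpace ℝ (Fin m))) = u := by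
    intro u
    simpa using (EuclideanSpace.basisFun (Fin m) ℝ).sum_repr u
  have hML : M * L = 1 := by
    refine (EuclideanSpace.basisFun (Fin m) ℝ).toBasis.ext fun b => ?_
    ext a
    have := coordCovec_coordVec he hx a b
    simp only [OrthonormalBasis.coe_toBasis, EuclideanSpace.basisFun_apply, Module.End.one_apply,
      PiLp.single_apply]
    exact this
  have hLM : L * M = 1 := mul_eq_one_comm.mp hML
  have h1 : L (M w) = w := congrArg (fun T : Module.End ℝ (EuclideanSpace ℝ (Fin m)) => T w) hLM
  rw [← key (M w), map_sum] at h1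
  simp only [map_smul] at h1
  exact h1

end chart
end MetricHypersurfaceData

namespace MetricHypersurfaceData

variable {m : ℕ} {N : Type*} [TopologicalSpace N] [ChartedSpace (EuclideanSpace ℝ (Fin m)) N]
  [IsManifold (𝓡 m) ∞ N] (D : MetricHypersurfaceData m N)
  {e : OpenPartialHomeomorph N (EuclideanSpace ℝ (Fin m))} {x : EuclideanSpace ℝ (Fin m)}

theorem γC_symm (a b : Fin m) (y : EuclideanSpace ℝ (Fin m)) : D.γC e a b y = D.γC e b a y :=
  D.γ_symm _ _ _

theorem γC_nC (he : e ∈ IsManifold.maximalAtlas (𝓡 m) ∞ N) (hx : x ∈ e.target) (b : Fin m) :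
    ∑ a, D.γC e a b x * D.nC e a x + D.n2C e x * D.ellC e b x = 0 := by
  have h := D.γ_n (e.symm x) (coordVec e b x)
  rw [← sum_coordVec he hx (D.n (e.symm x)), map_sum] at h
  simp only [map_smul, sum_apply, smul_apply, smul_eq_mul] at h
  simp only [γC, nC, n2C, ellC]
  rw [← h]
  congr 1
  exact Finset.sum_congr rfl fun a _ => mul_comm _ _

theorem ellC_nC (he : e ∈ IsManifold.maximalAtlas (𝓡 m) ∞ N) (hx : x ∈ e.target) :
    ∑ a, D.ellC e a x * D.nC e a x + D.n2C e x * D.ell2C e x = 1 := by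
  have h := D.ell_n (e.symm x)
  nth_rw 1 [← sum_coordVec he hx (D.n (e.symm x))] at h
  rw [map_sum] at h
  simp only [map_smul, smul_eq_mul] at h
  simp only [nC, n2C, ellC, ell2C]
  rw [← h]
  congr 1
  exact Finset.sum_congr rfl fun a _ => mul_comm _ _

theorem covec_eq_sum (he : e ∈ IsManifold.maximalAtlas (𝓡 m) ∞ N) (hx : x ∈ e.target)
    (α : Module.Dual ℝ (TangentSpace (𝓡 m) (e.symm x))) :
    α = ∑ b, α (coordVec e b x) • coordCovec e b x := by
  ext v
  conv_lhs => rw [← sum_coordVec he hx v, map_sum]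
  simp [mul_comm]

theorem PC_ellC (he : e ∈ IsManifold.maximalAtlas (𝓡 m) ∞ N) (hx : x ∈ e.target) (a : Fin m) :
    ∑ b, D.PC e a b x * D.ellC e b x + D.ell2C e x * D.nC e a x = 0 := by
  have h := D.P_ell (e.symm x) (coordCovec e a x)
  rw [covec_eq_sum he hx (D.ell (e.symm x)).toLinearMap, P_sum] at h
  simp only [PC, ellC, ell2C, nC]
  rw [← h]
  congr 1
  exact Finset.sum_congr rfl fun b _ => mul_comm _ _

theorem PC_γC (he : e ∈ IsManifold.maximalAtlas (𝓡 m) ∞ N) (hx : x ∈ e.target) (a c : Fin m) :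
    ∑ b, D.PC e a b x * D.γC e b c x + D.ellC e c x * D.nC e a x = if a = c then 1 else 0 := by
  have h := D.P_γ (e.symm x) (coordCovec e a x) (coordVec e c x)
  rw [covec_eq_sum he hx (D.γ (e.symm x) (coordVec e c x)).toLinearMap, P_sum,
    coordCovec_coordVec he hx] at h
  rw [← h]
  simp only [PC, ellC, nC]
  congr 1
  refine Finset.sum_congr rfl fun b _ => ?_
  rw [mul_comm, γC_symm]
  rfl

/-- The matrix of `𝓐` in a chart. -/
def ambientMatrix (e : OpenPartialHomeomorph N (EuclideanSpace ℝ (Fin m)))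
    (x : EuclideanSpace ℝ (Fin m)) : Matrix (Fin m ⊕ Unit) (Fin m ⊕ Unit) ℝ :=
  Matrix.of fun i j => Sum.elim
    (fun a => Sum.elim (fun b => D.γC e a b x) (fun _ => D.ellC e a x) j)
    (fun _ => Sum.elim (fun b => D.ellC e b x) (fun _ => D.ell2C e x) j) i

/-- The matrix of the inverse of `𝓐` in a chart. -/
def inverseMatrix (e : OpenPartialHomeomorph N (EuclideanSpace ℝ (Fin m)))
    (x : EuclideanSpace ℝ (Fin m)) : Matrix (Fin m ⊕ Unit) (Fin m ⊕ Unit) ℝ :=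
  Matrix.of fun i j => Sum.elim
    (fun a => Sum.elim (fun b => D.PC e a b x) (fun _ => D.nC e a x) j)
    (fun _ => Sum.elim (fun b => D.nC e b x) (fun _ => D.n2C e x) j) i

theorem inverse_mul_ambient (he : e ∈ IsManifold.maximalAtlas (𝓡 m) ∞ N) (hx : x ∈ e.target) :
    D.inverseMatrix e x * D.ambientMatrix e x = 1 := by
  ext i j
  rcases i with a | _ <;> rcases j with c | _ <;>
    simp only [Matrix.mul_apply, Fintype.sum_sum_type, inverseMatrix, ambientMatrix,
      Matrix.of_apply, Sum.elim_inl, Sum.elim_inr, Finset.univ_unique, Finset.sum_singleton,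
      Matrix.one_apply, Sum.inl.injEq, reduceCtorEq, if_false]
  · rw [← D.PC_γC he hx a c]; ring
  · rw [← D.PC_ellC he hx a]; ring
  · rw [← D.γC_nC he hx c]
    congr 1
    refine Finset.sum_congr rfl fun b _ => ?_
    rw [mul_comm]
  · rw [if_true, ← D.ellC_nC he hx]
    congr 1
    exact Finset.sum_congr rfl fun b _ => mul_comm _ _

theorem contMDiffOn_coordVec (he : e ∈ IsManifold.maximalAtlas (𝓡 m) ∞ N) (a : Fin m) :
    ContMDiffOn (𝓡 m) ((𝓡 m).prod (𝓡 m)) ∞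
      (fun x => TotalSpace.mk' (EuclideanSpace ℝ (Fin m)) (E := fun p : N => TangentSpace (𝓡 m) p)
        (e.symm x) (coordVec e a x)) e.target := by
  have hs : ContMDiffOn (𝓡 m) (𝓡 m) ∞ e.symm e.target := contMDiffOn_symm_of_mem_maximalAtlas he
  have ht := hs.contMDiffOn_tangentMapWithin (m := ∞) (by simp) e.open_target.uniqueMDiffOn
  have hv : ContMDiff (𝓡 m) ((𝓡 m).prod (𝓡 m)) ∞
      (fun x : EuclideanSpace ℝ (Fin m) => (⟨x, EuclideanSpace.single a (1 : ℝ)⟩ :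
        TangentBundle (𝓡 m) (EuclideanSpace ℝ (Fin m)))) := by
    rw [← contMDiffOn_univ]
    exact contMDiffOn_vectorSpace_iff_contDiffOn.2 contDiffOn_const
  refine (ht.comp (hv.contMDiffOn (s := e.target)) (fun x hx => hx)).congr fun x hx => ?_
  simp only [Function.comp, tangentMapWithin, coordVec]
  rw [mfderivWithin_of_isOpen e.open_target hx]

theorem contDiffOn_pair {Y : ∀ p : N, TangentSpace (𝓡 m) p →L[ℝ] TangentSpace (𝓡 m) p →L[ℝ] ℝ}
    (hY : ContMDiff (𝓡 m)
      ((𝓡 m).prod 𝓘(ℝ, EuclideanSpace ℝ (Fin m) →L[ℝ] EuclideanSpace ℝ (Fin m) →L[ℝ] ℝ)) ∞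
      (fun p => TotalSpace.mk'
        (EuclideanSpace ℝ (Fin m) →L[ℝ] EuclideanSpace ℝ (Fin m) →L[ℝ] ℝ)
        (E := fun p : N => TangentSpace (𝓡 m) p →L[ℝ] TangentSpace (𝓡 m) p →L[ℝ] ℝ) p (Y p)))
    (he : e ∈ IsManifold.maximalAtlas (𝓡 m) ∞ N) (a b : Fin m) :
    ContDiffOn ℝ ∞ (fun x => Y (e.symm x) (coordVec e a x) (coordVec e b x)) e.target := by
  have hs : ContMDiffOn (𝓡 m) (𝓡 m) ∞ e.symm e.target := contMDiffOn_symm_of_mem_maximalAtlas he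
  rw [← contMDiffOn_iff_contDiffOn]
  intro x hx
  have : ContMDiffWithinAt (𝓡 m) ((𝓡 m).prod 𝓘(ℝ)) ∞
      (fun x => TotalSpace.mk' ℝ (E := Bundle.Trivial N ℝ) (e.symm x)
        (Y (e.symm x) (coordVec e a x) (coordVec e b x))) e.target x := by
    apply ContMDiffWithinAt.clm_bundle_apply₂ (F₁ := EuclideanSpace ℝ (Fin m))
      (F₂ := EuclideanSpace ℝ (Fin m))
    · exact ContMDiffAt.comp_contMDiffWithinAt x hY.contMDiffAt (hs x hx)
    · exact contMDiffOn_coordVec he a x hx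
    · exact contMDiffOn_coordVec he b x hx
  simp only [contMDiffWithinAt_totalSpace] at this
  exact this.2

theorem contDiffOn_γC (he : e ∈ IsManifold.maximalAtlas (𝓡 m) ∞ N) (a b : Fin m) :
    ContDiffOn ℝ ∞ (D.γC e a b) e.target := contDiffOn_pair D.γ_smooth he a b

theorem contDiffOn_ellC (he : e ∈ IsManifold.maximalAtlas (𝓡 m) ∞ N) (a : Fin m) :
    ContDiffOn ℝ ∞ (D.ellC e a) e.target := by
  have hs : ContMDiffOn (𝓡 m) (𝓡 m) ∞ e.symm e.target := contMDiffOn_symm_of_mem_maximalAtlas he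
  rw [← contMDiffOn_iff_contDiffOn]
  intro x hx
  have : ContMDiffWithinAt (𝓡 m) ((𝓡 m).prod 𝓘(ℝ)) ∞
      (fun x => TotalSpace.mk' ℝ (E := Bundle.Trivial N ℝ) (e.symm x) (D.ellC e a x))
      e.target x := by
    apply ContMDiffWithinAt.clm_bundle_apply (F₁ := EuclideanSpace ℝ (Fin m))
    · exact ContMDiffAt.comp_contMDiffWithinAt x D.ell_smooth.contMDiffAt (hs x hx)
    · exact contMDiffOn_coordVec he a x hx
  simp only [contMDiffWithinAt_totalSpace] at this
  exact this.2

theorem contDiffOn_ell2C (he : e ∈ IsManifold.maximalAtlas (𝓡 m) ∞ N) :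
    ContDiffOn ℝ ∞ (D.ell2C e) e.target := by
  rw [← contMDiffOn_iff_contDiffOn]
  exact D.ell2_smooth.comp_contMDiffOn (contMDiffOn_symm_of_mem_maximalAtlas he)

theorem contDiffOn_ambientMatrix (he : e ∈ IsManifold.maximalAtlas (𝓡 m) ∞ N)
    (i j : Fin m ⊕ Unit) : ContDiffOn ℝ ∞ (fun x => D.ambientMatrix e x i j) e.target := by
  rcases i with a | _ <;> rcases j with b | _
  · exact D.contDiffOn_γC he a b
  · exact D.contDiffOn_ellC he a
  · exact D.contDiffOn_ellC he b
  · exact D.contDiffOn_ell2C he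

theorem contDiffOn_det {ι : Type*} [Fintype ι] [DecidableEq ι]
    {M : EuclideanSpace ℝ (Fin m) → Matrix ι ι ℝ} {s : Set (EuclideanSpace ℝ (Fin m))}
    (hM : ∀ i j, ContDiffOn ℝ ∞ (fun x => M x i j) s) :
    ContDiffOn ℝ ∞ (fun x => (M x).det) s := by
  simp only [Matrix.det_apply']
  refine ContDiffOn.sum fun σ _ => contDiffOn_const.mul ?_
  exact contDiffOn_prod fun i _ => hM _ _

theorem contDiffOn_inverseMatrix (he : e ∈ IsManifold.maximalAtlas (𝓡 m) ∞ N)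
    (i j : Fin m ⊕ Unit) : ContDiffOn ℝ ∞ (fun x => D.inverseMatrix e x i j) e.target := by
  have hdet : ∀ x ∈ e.target, (D.ambientMatrix e x).det ≠ 0 := fun x hx h0 => by
    have := congrArg Matrix.det (D.inverse_mul_ambient he hx)
    simp [h0] at this
  have h1 : ∀ x ∈ e.target, D.inverseMatrix e x i j
      = (D.ambientMatrix e x).det⁻¹ * (D.ambientMatrix e x).adjugate i j := fun x hx => by
    rw [← Matrix.inv_eq_left_inv (D.inverse_mul_ambient he hx), Matrix.inv_def,
      Ring.inverse_eq_inv', Matrix.smul_apply, smul_eq_mul]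
  refine ContDiffOn.congr ?_ h1
  refine ((contDiffOn_det (D.contDiffOn_ambientMatrix he)).inv hdet).mul ?_
  simp only [Matrix.adjugate_apply]
  refine contDiffOn_det fun k l => ?_
  by_cases hk : k = j
  · subst hk
    simp only [Matrix.updateRow_self]
    exact contDiffOn_const
  · simp only [Matrix.updateRow_ne hk]
    exact D.contDiffOn_ambientMatrix he k l

theorem contDiffOn_nC (he : e ∈ IsManifold.maximalAtlas (𝓡 m) ∞ N) (a : Fin m) :
    ContDiffOn ℝ ∞ (D.nC e a) e.target :=
  D.contDiffOn_inverseMatrix he (Sum.inl a) (Sum.inr ())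

theorem contDiffOn_n2C (he : e ∈ IsManifold.maximalAtlas (𝓡 m) ∞ N) :
    ContDiffOn ℝ ∞ (D.n2C e) e.target :=
  D.contDiffOn_inverseMatrix he (Sum.inr ()) (Sum.inr ())

/-- The derivative of `γ_eb n^e + n₂ ℓ_b = 0`. -/
theorem pd_γC_nC (he : e ∈ IsManifold.maximalAtlas (𝓡 m) ∞ N) (hx : x ∈ e.target) (a b : Fin m) :
    ∑ f, (pd a (D.γC e f b) x * D.nC e f x + D.γC e f b x * pd a (D.nC e f) x)
      + (pd a (D.n2C e) x * D.ellC e b x + D.n2C e x * pd a (D.ellC e b) x) = 0 := by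
  have hg := fun f => differentiableAt_of_contDiffOn (D.contDiffOn_γC he f b) hx
  have hn := fun f => differentiableAt_of_contDiffOn (D.contDiffOn_nC he f) hx
  have h2 := differentiableAt_of_contDiffOn (D.contDiffOn_n2C he) hx
  have hl := differentiableAt_of_contDiffOn (D.contDiffOn_ellC he b) hx
  have h : HasFDerivAt (fun y => ∑ f, D.γC e f b y * D.nC e f y + D.n2C e y * D.ellC e b y) _ x :=
    (HasFDerivAt.fun_sum fun f _ => ((hg f).hasFDerivAt.mul (hn f).hasFDerivAt)).add
      (h2.hasFDerivAt.mul hl.hasFDerivAt)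
  have h0 : HasFDerivAt (fun y => ∑ f, D.γC e f b y * D.nC e f y + D.n2C e y * D.ellC e b y)
      (0 : EuclideanSpace ℝ (Fin m) →L[ℝ] ℝ) x := by
    refine (hasFDerivAt_const (0 : ℝ) x).congr_of_eventuallyEq ?_
    filter_upwards [e.open_target.mem_nhds hx] with y hy
    exact D.γC_nC he hy b
  have h3 := congrArg (fun L => L (EuclideanSpace.single a (1 : ℝ))) (h.unique h0)
  simp only [add_apply, sum_apply, smul_apply, smul_eq_mul, zero_apply] at h3
  rw [← h3]
  simp only [pd]
  congr 1
  · exact Finset.sum_congr rfl fun f _ => by ring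
  · ring

theorem UC_eq (he : e ∈ IsManifold.maximalAtlas (𝓡 m) ∞ N) (hx : x ∈ e.target) (a b : Fin m) :
    D.UC e a b x = -(∑ f, D.nC e f x *
        (pd a (D.γC e b f) x + pd b (D.γC e a f) x - pd f (D.γC e a b) x)) / 2
      - D.n2C e x * (pd a (D.ellC e b) x + pd b (D.ellC e a) x) / 2 := by
  have h1 := D.pd_γC_nC he hx a b
  have h2 := D.pd_γC_nC he hx b a
  have hs : ∀ a b, D.γC e a b = D.γC e b a := fun a b => funext fun y => D.γC_symm a b y
  simp only [UC, lieD, vecD, symPart]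
  have e1 : ∑ f, D.γC e a f x * pd b (D.nC e f) x = ∑ f, D.γC e f a x * pd b (D.nC e f) x :=
    Finset.sum_congr rfl fun f _ => by rw [hs]
  have e2 : ∑ f, D.nC e f x *
        (pd a (D.γC e b f) x + pd b (D.γC e a f) x - pd f (D.γC e a b) x)
      = ∑ f, pd a (D.γC e f b) x * D.nC e f x + ∑ f, pd b (D.γC e f a) x * D.nC e f x
        - ∑ f, D.nC e f x * pd f (D.γC e a b) x := by
    rw [← Finset.sum_add_distrib, ← Finset.sum_sub_distrib]
    exact Finset.sum_congr rfl fun f _ => by rw [hs b f, hs a f]; ring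
  rw [Finset.sum_add_distrib] at h1 h2
  rw [e1, e2]
  linarith

theorem Γ_symm (c a b : Fin m) : D.Γ e c a b x = D.Γ e c b a x := by
  have hs : D.γC e a b = D.γC e b a := funext fun y => D.γC_symm a b y
  simp only [Γ]
  rw [hs]
  congr 2
  · exact Finset.sum_congr rfl fun d _ => by ring
  · ring

theorem PC_symm (he : e ∈ IsManifold.maximalAtlas (𝓡 m) ∞ N) (hx : x ∈ e.target) (a b : Fin m) :
    D.PC e a b x = D.PC e b a x := by
  have h1 := D.inverse_mul_ambient he hx
  have hA : (D.ambientMatrix e x).transpose = D.ambientMatrix e x := by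
    ext i j
    rcases i with a | _ <;> rcases j with c | _ <;> simp [ambientMatrix, D.γC_symm]
  have h2 := congrArg Matrix.transpose h1
  rw [Matrix.transpose_mul, hA, Matrix.transpose_one] at h2
  have h3 : (D.inverseMatrix e x).transpose = D.inverseMatrix e x := by
    rw [← Matrix.inv_eq_right_inv h2, Matrix.inv_eq_left_inv h1]
  exact congrFun (congrFun h3 (Sum.inl b)) (Sum.inl a)

theorem γC_PC (he : e ∈ IsManifold.maximalAtlas (𝓡 m) ∞ N) (hx : x ∈ e.target) (a c : Fin m) :
    ∑ b, D.γC e a b x * D.PC e b c x + D.ellC e a x * D.nC e c x = if a = c then 1 else 0 := by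
  have := D.PC_γC he hx c a
  simp only [eq_comm (a := c)] at this
  rw [← this]
  congr 1
  exact Finset.sum_congr rfl fun b _ => by rw [D.γC_symm, D.PC_symm he hx b c, mul_comm]

/-- `γ_cf Γ^c_ab` -/
theorem γC_Γ (he : e ∈ IsManifold.maximalAtlas (𝓡 m) ∞ N) (hx : x ∈ e.target) (a b f : Fin m) :
    ∑ c, D.Γ e c a b x * D.γC e c f x =
      (pd a (D.γC e b f) x + pd b (D.γC e a f) x - pd f (D.γC e a b) x) / 2
        + D.ellC e f x * D.UC e a b x := by
  rw [D.UC_eq he hx]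
  set κ : Fin m → ℝ := fun d =>
    pd a (D.γC e b d) x + pd b (D.γC e a d) x - pd d (D.γC e a b) x with hκ
  set t := pd a (D.ellC e b) x + pd b (D.ellC e a) x with ht
  have e1 : ∑ c, D.Γ e c a b x * D.γC e c f x
      = (∑ d, (∑ c, D.γC e f c x * D.PC e c d x) * κ d) / 2
        + (∑ c, D.γC e c f x * D.nC e c x) * t / 2 := by
    simp only [Γ, Finset.sum_mul, Finset.sum_div]
    rw [Finset.sum_comm, ← Finset.sum_add_distrib]
    refine Finset.sum_congr rfl fun c _ => ?_
    rw [← ht, add_mul, Finset.sum_mul, D.γC_symm c f]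
    congr 1
    · exact Finset.sum_congr rfl fun d _ => by simp only [hκ]; ring
    · ring
  have e2 : ∀ d, ∑ c, D.γC e f c x * D.PC e c d x
      = (if f = d then 1 else 0) - D.ellC e f x * D.nC e d x := fun d => by
    rw [← D.γC_PC he hx f d]; ring
  have e3 : ∑ c, D.γC e c f x * D.nC e c x = - (D.n2C e x * D.ellC e f x) := by
    have := D.γC_nC he hx f; linarith
  rw [e1, e3]
  simp only [e2, sub_mul, Finset.sum_sub_distrib, ite_mul, one_mul, zero_mul,
    Finset.sum_ite_eq, Finset.mem_univ, if_true]
  have e4 : ∑ d, D.ellC e f x * D.nC e d x * κ d = D.ellC e f x * ∑ d, D.nC e d x * κ d := by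
    rw [Finset.mul_sum]
    exact Finset.sum_congr rfl fun d _ => by ring
  rw [e4]
  ring

/-- `ℓ_c Γ^c_ab` -/
theorem ellC_Γ (he : e ∈ IsManifold.maximalAtlas (𝓡 m) ∞ N) (hx : x ∈ e.target) (a b : Fin m) :
    ∑ c, D.Γ e c a b x * D.ellC e c x =
      (pd a (D.ellC e b) x + pd b (D.ellC e a) x) / 2 + D.ell2C e x * D.UC e a b x := by
  rw [D.UC_eq he hx]
  set κ : Fin m → ℝ := fun d =>
    pd a (D.γC e b d) x + pd b (D.γC e a d) x - pd d (D.γC e a b) x with hκ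
  set t := pd a (D.ellC e b) x + pd b (D.ellC e a) x with ht
  have e1 : ∑ c, D.Γ e c a b x * D.ellC e c x
      = (∑ d, (∑ c, D.PC e d c x * D.ellC e c x) * κ d) / 2
        + (∑ c, D.ellC e c x * D.nC e c x) * t / 2 := by
    simp only [Γ, Finset.sum_mul, Finset.sum_div]
    rw [Finset.sum_comm, ← Finset.sum_add_distrib]
    refine Finset.sum_congr rfl fun c _ => ?_
    rw [← ht, add_mul, Finset.sum_mul]
    congr 1
    · exact Finset.sum_congr rfl fun d _ => by simp only [hκ]; rw [D.PC_symm he hx d c]; ring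
    · ring
  have e2 : ∀ d, ∑ c, D.PC e d c x * D.ellC e c x = - (D.ell2C e x * D.nC e d x) := fun d => by
    have := D.PC_ellC he hx d; linarith
  have e3 : ∑ c, D.ellC e c x * D.nC e c x = 1 - D.n2C e x * D.ell2C e x := by
    have := D.ellC_nC he hx; linarith
  rw [e1, e3]
  simp only [e2]
  have e4 : ∑ d, -(D.ell2C e x * D.nC e d x) * κ d = - D.ell2C e x * ∑ d, D.nC e d x * κ d := by
    rw [Finset.mul_sum]
    exact Finset.sum_congr rfl fun d _ => by ring
  rw [e4]
  ring

/-- The functions `Γ^c_ab` satisfy the defining conditions of the metric hypersurface connection: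
it is torsion-free, `∇_a γ_bc = - U_ab ℓ_c - U_ac ℓ_b` and
`∇_a ℓ_b + ∇_b ℓ_a = - 2 ℓ₂ U_ab`. -/
theorem Γ_spec (he : e ∈ IsManifold.maximalAtlas (𝓡 m) ∞ N) (hx : x ∈ e.target) :
    (∀ c a b, D.Γ e c a b x = D.Γ e c b a x) ∧
    (∀ a b c, covD₂ (D.Γ e) (D.γC e) a b c x
      = - D.UC e a b x * D.ellC e c x - D.UC e a c x * D.ellC e b x) ∧
    (∀ a b, covD₁ (D.Γ e) (D.ellC e) a b x + covD₁ (D.Γ e) (D.ellC e) b a x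
      = - 2 * D.ell2C e x * D.UC e a b x) := by
  have hs : ∀ a b, D.γC e a b = D.γC e b a := fun a b => funext fun y => D.γC_symm a b y
  refine ⟨fun c a b => D.Γ_symm c a b, fun a b c => ?_, fun a b => ?_⟩
  · have h1 := D.γC_Γ he hx a b c
    have h2 := D.γC_Γ he hx a c b
    have e2 : ∑ f, D.Γ e f a c x * D.γC e b f x = ∑ f, D.Γ e f a c x * D.γC e f b x :=
      Finset.sum_congr rfl fun f _ => by rw [hs]
    rw [covD₂, e2, h1, h2, hs c b, hs a b, hs a c]
    ring
  · have h1 := D.ellC_Γ he hx a b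
    have h2 : ∑ c, D.Γ e c b a x * D.ellC e c x = ∑ c, D.Γ e c a b x * D.ellC e c x :=
      Finset.sum_congr rfl fun c _ => by rw [D.Γ_symm]
    rw [covD₁, covD₁, h2, h1]
    ring

/-- Any torsion-free connection with `∇_a γ_bc = - U_ab ℓ_c - U_ac ℓ_b` and
`∇_a ℓ_b + ∇_b ℓ_a = - 2 ℓ₂ U_ab` has the coefficients `Γ^c_ab`. -/
theorem Γ_unique (he : e ∈ IsManifold.maximalAtlas (𝓡 m) ∞ N) (hx : x ∈ e.target)
    (G : Fin m → Fin m → Fin m → EuclideanSpace ℝ (Fin m) → ℝ)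
    (h0 : ∀ c a b, G c a b x = G c b a x)
    (h1 : ∀ a b c, covD₂ G (D.γC e) a b c x
      = - D.UC e a b x * D.ellC e c x - D.UC e a c x * D.ellC e b x)
    (h2 : ∀ a b, covD₁ G (D.ellC e) a b x + covD₁ G (D.ellC e) b a x
      = - 2 * D.ell2C e x * D.UC e a b x) (c a b : Fin m) : G c a b x = D.Γ e c a b x := by
  obtain ⟨k0, k1, k2⟩ := D.Γ_spec he hx
  set L : Fin m → Fin m → Fin m → ℝ := fun a b c =>
    ∑ f, (G f a b x - D.Γ e f a b x) * D.γC e f c x with hL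
  have hLs : ∀ a b c, L a b c = L b a c := fun a b c => by
    simp only [hL]
    exact Finset.sum_congr rfl fun f _ => by rw [h0, k0]
  have hLa : ∀ a b c, L a b c + L a c b = 0 := fun a b c => by
    have i1 := h1 a b c
    have i2 := k1 a b c
    simp only [covD₂] at i1 i2
    simp only [hL, sub_mul, Finset.sum_sub_distrib]
    have e1 : ∀ G : Fin m → Fin m → Fin m → EuclideanSpace ℝ (Fin m) → ℝ,
        ∑ f, G f a c x * D.γC e b f x = ∑ f, G f a c x * D.γC e f b x := fun G =>
      Finset.sum_congr rfl fun f _ => by rw [D.γC_symm]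
    rw [e1] at i1 i2
    linarith
  have hL0 : ∀ a b c, L a b c = 0 := fun a b c => by
    have := hLa a b c
    have := hLa b c a
    have := hLa c a b
    have := hLs a b c
    have := hLs b c a
    have := hLs c a b
    linarith
  have hl : ∑ f, (G f a b x - D.Γ e f a b x) * D.ellC e f x = 0 := by
    have i1 := h2 a b
    have i2 := k2 a b
    simp only [covD₁] at i1 i2
    have e1 : ∑ f, G f b a x * D.ellC e f x = ∑ f, G f a b x * D.ellC e f x :=
      Finset.sum_congr rfl fun f _ => by rw [h0]
    have e2 : ∑ f, D.Γ e f b a x * D.ellC e f x = ∑ f, D.Γ e f a b x * D.ellC e f x :=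
      Finset.sum_congr rfl fun f _ => by rw [k0]
    rw [e1] at i1
    rw [e2] at i2
    simp only [sub_mul, Finset.sum_sub_distrib]
    linarith
  have hd : G c a b x - D.Γ e c a b x
      = ∑ f, (G f a b x - D.Γ e f a b x) * (if c = f then 1 else 0) := by simp
  have key : ∑ f, (G f a b x - D.Γ e f a b x) * (if c = f then 1 else 0)
      = ∑ d, D.PC e c d x * L a b d
        + D.nC e c x * ∑ f, (G f a b x - D.Γ e f a b x) * D.ellC e f x := by
    simp only [hL, Finset.mul_sum]
    rw [Finset.sum_comm, ← Finset.sum_add_distrib]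
    refine Finset.sum_congr rfl fun f _ => ?_
    rw [← D.PC_γC he hx c f, mul_add, Finset.mul_sum]
    congr 1
    · exact Finset.sum_congr rfl fun d _ => by rw [D.γC_symm d f]; ring
    · ring
  have : G c a b x - D.Γ e c a b x = 0 := by
    rw [hd, key, hl]
    simp [hL0]
  linarith

end MetricHypersurfaceData

namespace MetricHypersurfaceData

variable {m : ℕ} {N : Type*} [TopologicalSpace N] [ChartedSpace (EuclideanSpace ℝ (Fin m)) N]
  [IsManifold (𝓡 m) ∞ N] (D : MetricHypersurfaceData m N)
  (e : OpenPartialHomeomorph N (EuclideanSpace ℝ (Fin m)))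

/-- The curvature tensor `R^a_bcd` of the metric hypersurface connection. -/
def riem (a b c d : Fin m) (x : EuclideanSpace ℝ (Fin m)) : ℝ := curvature (D.Γ e) a b c d x

/-- The Ricci tensor `R_bd` of the metric hypersurface connection. -/
def ric (b d : Fin m) (x : EuclideanSpace ℝ (Fin m)) : ℝ := ricci (D.Γ e) b d x

/-- `∇_a θ_b` for the metric hypersurface connection. -/
def nabla₁ (θ : Fin m → EuclideanSpace ℝ (Fin m) → ℝ) (a b : Fin m)
    (x : EuclideanSpace ℝ (Fin m)) : ℝ := covD₁ (D.Γ e) θ a b x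

/-- `∇_a T_bc` for the metric hypersurface connection. -/
def nabla₂ (T : Fin m → Fin m → EuclideanSpace ℝ (Fin m) → ℝ) (a b c : Fin m)
    (x : EuclideanSpace ℝ (Fin m)) : ℝ := covD₂ (D.Γ e) T a b c x

/-- `tr_P T = P^ab T_ab` -/
def trP (T : Fin m → Fin m → EuclideanSpace ℝ (Fin m) → ℝ) (x : EuclideanSpace ℝ (Fin m)) : ℝ :=
  ∑ a, ∑ b, D.PC e a b x * T a b x

end MetricHypersurfaceData

namespace HypersurfaceData

variable {m : ℕ} {N : Type*} [TopologicalSpace N] [ChartedSpace (EuclideanSpace ℝ (Fin m)) N]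
  [IsManifold (𝓡 m) ∞ N] (D : HypersurfaceData m N)
  (e : OpenPartialHomeomorph N (EuclideanSpace ℝ (Fin m)))

/-- `Y_ab` -/
def YC (a b : Fin m) (x : EuclideanSpace ℝ (Fin m)) : ℝ :=
  D.Y (e.symm x) (coordVec e a x) (coordVec e b x)

/-- `r = Y(n, ·)` -/
def rC (b : Fin m) (x : EuclideanSpace ℝ (Fin m)) : ℝ := ∑ a, D.nC e a x * D.YC e a b x

/-- `κ_n = - Y(n, n)` -/
def κ (x : EuclideanSpace ℝ (Fin m)) : ℝ := -∑ a, ∑ b, D.nC e a x * D.nC e b x * D.YC e a b x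

/-- The tensor
`A_bcd = ℓ_a R^a_bcd + 2 ∇_[d Y_c]b + 2 ℓ₂ ∇_[d U_c]b + U_b[c ∇_d] ℓ₂
  + Y_b[d (2 (F_c]f + Y_c]f) n^f + n₂ ∇_c] ℓ₂)`. -/
def A (b c d : Fin m) (x : EuclideanSpace ℝ (Fin m)) : ℝ :=
  ∑ a, D.ellC e a x * D.riem e a b c d x
    + 2 * altPart (fun d c => D.nabla₂ e (D.YC e) d c b x) d c
    + 2 * D.ell2C e x * altPart (fun d c => D.nabla₂ e (D.UC e) d c b x) d c
    + altPart (fun c d => D.UC e b c x * pd d (D.ell2C e) x) c d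
    + altPart (fun d c => D.YC e b d x *
        (∑ f, 2 * (D.FC e c f x + D.YC e c f x) * D.nC e f x
          + D.n2C e x * pd c (D.ell2C e) x)) d c

/-- The tensor
`B_abcd = γ_af R^f_bcd + 2 ℓ_a ∇_[d U_c]b + 2 Y_b[c U_d]a + 2 U_b[c (Y_d]a + F_d]a)
  + 2 n₂ Y_b[c Y_d]a`. -/
def B (a b c d : Fin m) (x : EuclideanSpace ℝ (Fin m)) : ℝ :=
  ∑ f, D.γC e a f x * D.riem e f b c d x
    + 2 * D.ellC e a x * altPart (fun d c => D.nabla₂ e (D.UC e) d c b x) d c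
    + 2 * altPart (fun c d => D.YC e b c x * D.UC e d a x) c d
    + 2 * altPart (fun c d => D.UC e b c x * (D.YC e d a x + D.FC e d a x)) c d
    + 2 * D.n2C e x * altPart (fun c d => D.YC e b c x * D.YC e d a x) c d

/-- The constraint tensor. -/
def constraintTensor (b d : Fin m) (x : EuclideanSpace ℝ (Fin m)) : ℝ :=
  symPart (fun b d => D.ric e b d x) b d
    - 2 * lieD (D.nC e) (D.YC e) b d x
    - (2 * D.κ e x + D.trP e (D.UC e) x
        - D.n2C e x * (vecD (D.nC e) (D.ell2C e) x - D.trP e (D.YC e) x)) * D.YC e b d x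
    + symPart (fun b d => D.nabla₁ e (fun a y => D.sC e a y + 2 * D.rC e a y) b d x) b d
    - 2 * D.rC e b x * D.rC e d x
    + 4 * symPart (fun b d => D.rC e b x * D.sC e d x) b d
    - D.sC e b x * D.sC e d x
    - D.trP e (D.YC e) x * D.UC e b d x
    + 2 * ∑ a, ∑ c, D.PC e a c x *
        symPart (fun b d => D.UC e a b x * (2 * D.YC e d c x + D.FC e d c x)) b d
    + D.n2C e x *
        (symPart (fun b d => (D.sC e b x - 3 * D.rC e b x) * pd d (D.ell2C e) x) b d
          + ∑ a, ∑ c, D.PC e a c x *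
              ((D.YC e a b x + D.FC e a b x) * (D.YC e c d x + D.FC e c d x)
                - 2 * D.FC e a b x * D.FC e c d x))

end HypersurfaceData

end

open CoordCalc

/-! All identities are checked by components in an arbitrary chart, where the blocks of the inverse
of `𝓐` satisfy four relations: γ(n,·) + n₂ℓ = 0, ℓ(n) + n₂ℓ₂ = 1, Pℓ + ℓ₂n = 0 and Pγ + n⊗ℓ = id.

Differentiating the first two gives γ_cb∇_a n^c and ℓ_c∇_a n^c; the last one reassembles ∇n from
these two pairings (`covDVec_nC`), and a contraction with n gives U(n,·) (`sum_nC_UC`). Next, ∇_aℓ_b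
= F_ab - ℓ₂U_ab, so the Ricci identity for ℓ, together with dF = 0, expresses ℓ_a R^a_bcd through
∇_b F_cd, ∇U and dℓ₂ (`ellC_riem`). This is what both contractions need. In A the terms ℓ₂∇U cancel
outright (`A_eq`); in n^c A_bcd, n is then moved inside the derivatives of F and Y at the cost of
terms in ∇n, and symmetrization in b, d produces £_n Y. In P^ac B_abcd, P^ac γ_af = δ^c_f - n^c ℓ_f
turns the curvature term into R_bd - n^c ℓ_f R^f_bcd, while P^ac ℓ_a = -ℓ₂n^c makes the ∇U terms
cancel again.

The trace of B comes out with R_bd and ∇_b s_d unsymmetrized. To symmetrize it one needs R_[bd]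
(`ric_sub_swap`): by the contracted first Bianchi identity it is half the curl of Γ^a_ab, and Γ^a_ab
is half of tr(𝓐⁻¹∂𝓐), which is closed, plus s - n₂dℓ₂/2.

For the sum of the two contractions only linear algebra remains: derivatives of n₂ cancel, and the
quadratic terms agree after symmetrization in the indices contracted with P. -/

namespace CoordCalc

variable {m : ℕ} {f g : EuclideanSpace ℝ (Fin m) → ℝ} {x : EuclideanSpace ℝ (Fin m)}

/-! ### Rules for partial derivatives -/

theorem pd_add (hf : DifferentiableAt ℝ f x) (hg : DifferentiableAt ℝ g x) (a : Fin m) :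
    pd a (fun y => f y + g y) x = pd a f x + pd a g x := by
  simp [pd, fderiv_fun_add hf hg]

theorem pd_sub (hf : DifferentiableAt ℝ f x) (hg : DifferentiableAt ℝ g x) (a : Fin m) :
    pd a (fun y => f y - g y) x = pd a f x - pd a g x := by
  simp [pd, fderiv_fun_sub hf hg]

theorem pd_mul (hf : DifferentiableAt ℝ f x) (hg : DifferentiableAt ℝ g x) (a : Fin m) :
    pd a (fun y => f y * g y) x = pd a f x * g x + f x * pd a g x := by
  simp only [pd, fderiv_fun_mul hf hg, add_apply, smul_apply, smul_eq_mul]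
  ring

theorem pd_const_mul (hf : DifferentiableAt ℝ f x) (k : ℝ) (a : Fin m) :
    pd a (fun y => k * f y) x = k * pd a f x := by
  simp [pd, fderiv_const_mul hf]

theorem pd_div_const (hf : DifferentiableAt ℝ f x) (k : ℝ) (a : Fin m) :
    pd a (fun y => f y / k) x = pd a f x / k := by
  simp only [div_eq_inv_mul]
  exact pd_const_mul hf _ a

theorem pd_sum {ι : Type*} {s : Finset ι} {F : ι → EuclideanSpace ℝ (Fin m) → ℝ}
    (hF : ∀ i, DifferentiableAt ℝ (F i) x) (a : Fin m) :
    pd a (fun y => ∑ i ∈ s, F i y) x = ∑ i ∈ s, pd a (F i) x := by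
  simp [pd, fderiv_fun_sum fun i _ => hF i]

theorem pd_congr (h : f =ᶠ[nhds x] g) (a : Fin m) : pd a f x = pd a g x := by
  rw [pd, pd, h.fderiv_eq]

theorem pd_const (k : ℝ) (a : Fin m) : pd a (fun _ => k) x = 0 := by
  simp [pd]

theorem contDiffOn_pd {s : Set (EuclideanSpace ℝ (Fin m))} (hs : IsOpen s)
    (hf : ContDiffOn ℝ ∞ f s) (a : Fin m) : ContDiffOn ℝ ∞ (pd a f) s :=
  (hf.fderiv_of_isOpen hs (by simp)).clm_apply contDiffOn_const

theorem pd_comm (hf : ContDiffAt ℝ ∞ f x) (a b : Fin m) :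
    pd a (pd b f) x = pd b (pd a f) x := by
  have hd : DifferentiableAt ℝ (fderiv ℝ f) x :=
    (hf.fderiv_right (m := 1) (by norm_cast)).differentiableAt (by simp)
  have key : ∀ a b : Fin m, pd a (pd b f) x
      = fderiv ℝ (fderiv ℝ f) x (EuclideanSpace.single a 1) (EuclideanSpace.single b 1) := by
    intro a b
    change fderiv ℝ (fun y => fderiv ℝ f y (EuclideanSpace.single b 1)) x _ = _
    rw [fderiv_clm_apply hd (differentiableAt_const _)]
    simp
  rw [key, key]
  exact (hf.isSymmSndFDerivAt (by simp; norm_cast)).eq _ _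

/-! ### Covariant calculus and curvature for connection coefficients -/

/-- `∇_a v^c` for a vector field `v`. -/
noncomputable def covDVec (Γ : Fin m → Fin m → Fin m → EuclideanSpace ℝ (Fin m) → ℝ)
    (v : Fin m → EuclideanSpace ℝ (Fin m) → ℝ) (a c : Fin m) (x : EuclideanSpace ℝ (Fin m)) : ℝ :=
  pd a (v c) x + ∑ f, Γ c a f x * v f x

variable {Γ : Fin m → Fin m → Fin m → EuclideanSpace ℝ (Fin m) → ℝ}
  {v θ η : Fin m → EuclideanSpace ℝ (Fin m) → ℝ} {T S : Fin m → Fin m → EuclideanSpace ℝ (Fin m) → ℝ}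

theorem covD₁_add (hθ : ∀ a, DifferentiableAt ℝ (θ a) x) (hη : ∀ a, DifferentiableAt ℝ (η a) x)
    (a b : Fin m) :
    covD₁ Γ (fun a y => θ a y + η a y) a b x = covD₁ Γ θ a b x + covD₁ Γ η a b x := by
  simp only [covD₁, pd_add (hθ b) (hη b), mul_add, Finset.sum_add_distrib]
  ring

theorem covD₁_const_mul (hθ : ∀ a, DifferentiableAt ℝ (θ a) x) (k : ℝ) (a b : Fin m) :
    covD₁ Γ (fun a y => k * θ a y) a b x = k * covD₁ Γ θ a b x := by
  simp only [covD₁, pd_const_mul (hθ b), mul_sub, Finset.mul_sum]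
  congr 1
  exact Finset.sum_congr rfl fun c _ => by ring

/-- For a torsion-free connection the exterior derivative of a covector can be computed with ∇. It
serves to compare the curl of s in `ric_sub_swap` with ∇_[b s_d]. -/
theorem covD₁_sub_swap (hΓ : ∀ c a b, Γ c a b x = Γ c b a x) (a b : Fin m) :
    covD₁ Γ θ a b x - covD₁ Γ θ b a x = pd a (θ b) x - pd b (θ a) x := by
  simp only [covD₁, hΓ _ b a]
  ring

/-- Component identities hold only on the target of the chart; agreement near x suffices for
differentiating them there. -/
theorem covD₂_congr (h : ∀ᶠ y in nhds x, ∀ b c, T b c y = S b c y) (a b c : Fin m) :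
    covD₂ Γ T a b c x = covD₂ Γ S a b c x := by
  have hx := h.self_of_nhds
  simp only [covD₂, hx]
  rw [pd_congr (h.mono fun y hy => hy b c)]

/-- The Leibniz rule in the shape taken by ∇ℓ = F - ℓ₂U. -/
theorem covD₂_sub_mul (hT : ∀ a b, DifferentiableAt ℝ (T a b) x)
    (hS : ∀ a b, DifferentiableAt ℝ (S a b) x) (hf : DifferentiableAt ℝ f x) (a b c : Fin m) :
    covD₂ Γ (fun b c y => T b c y - f y * S b c y) a b c x
      = covD₂ Γ T a b c x - pd a f x * S b c x - f x * covD₂ Γ S a b c x := by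
  have h1 : ∀ b c, DifferentiableAt ℝ (fun y => f y * S b c y) x := fun b c => hf.mul (hS b c)
  simp only [covD₂, pd_sub (hT b c) (h1 b c), pd_mul hf (hS b c), mul_sub, Finset.sum_sub_distrib,
    Finset.mul_sum]
  have e1 : ∑ i, Γ i a b x * (f x * S i c x) = ∑ i, f x * (Γ i a b x * S i c x) :=
    Finset.sum_congr rfl fun i _ => by ring
  have e2 : ∑ i, Γ i a c x * (f x * S b i x) = ∑ i, f x * (Γ i a c x * S b i x) :=
    Finset.sum_congr rfl fun i _ => by ring
  rw [e1, e2]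
  ring

theorem covD₂_symm (hT : ∀ b c y, T b c y = T c b y) (a b c : Fin m) :
    covD₂ Γ T a b c x = covD₂ Γ T a c b x := by
  have h : T b c = T c b := funext (hT b c)
  simp only [covD₂, h, hT c, hT b]
  ring

/-- The Ricci identity for covectors. -/
theorem covD₂_covD₁_sub_swap (hΓs : ∀ c a b y, Γ c a b y = Γ c b a y)
    (hΓ : ∀ c a b, DifferentiableAt ℝ (Γ c a b) x) (hθ : ∀ a, ContDiffAt ℝ ∞ (θ a) x)
    (b c d : Fin m) :
    covD₂ Γ (covD₁ Γ θ) c d b x - covD₂ Γ (covD₁ Γ θ) d c b x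
      = -∑ a, θ a x * curvature Γ a b c d x := by
  have hθ1 : ∀ a, DifferentiableAt ℝ (θ a) x := fun a => (hθ a).differentiableAt (by simp)
  have hθ2 : ∀ a b, DifferentiableAt ℝ (pd a (θ b)) x := fun a b =>
    (((hθ b).fderiv_right (m := 1) (by norm_cast)).differentiableAt (by simp)).clm_apply
      (differentiableAt_const _)
  have hp : ∀ c d, pd c (covD₁ Γ θ d b) x = pd c (pd d (θ b)) x
      - ∑ a, (pd c (Γ a d b) x * θ a x + Γ a d b x * pd c (θ a) x) := by
    intro c d
    change pd c (fun y => pd d (θ b) y - ∑ a, Γ a d b y * θ a y) x = _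
    have h1 : ∀ a, DifferentiableAt ℝ (fun y => Γ a d b y * θ a y) x := fun a =>
      (hΓ a d b).mul (hθ1 a)
    rw [pd_sub (hθ2 d b) (DifferentiableAt.fun_sum fun a _ => h1 a), pd_sum h1]
    congr 1
    exact Finset.sum_congr rfl fun a _ => pd_mul (hΓ a d b) (hθ1 a) c
  -- Torsion-freeness removes the terms Γ^f_cd ∇_f θ_b. Of the rest, ∂∂θ and the products Γ∂θ are
  -- symmetric in c, d, so that only θ∂Γ and θΓΓ survive.
  have e0 : ∑ f, Γ f c d x * covD₁ Γ θ f b x = ∑ f, Γ f d c x * covD₁ Γ θ f b x :=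
    Finset.sum_congr rfl fun f _ => by rw [hΓs]
  have hq : ∀ c d, ∑ f, Γ f c b x * covD₁ Γ θ d f x
      = ∑ a, Γ a c b x * pd d (θ a) x - ∑ a, θ a x * ∑ f, Γ a d f x * Γ f c b x := by
    intro c d
    simp only [covD₁, mul_sub, Finset.sum_sub_distrib, Finset.mul_sum]
    congr 1
    rw [Finset.sum_comm]
    exact Finset.sum_congr rfl fun a _ => Finset.sum_congr rfl fun f _ => by ring
  rw [covD₂, covD₂, hp, hp, e0, hq, hq, pd_comm (hθ b) c d]
  simp only [curvature, mul_add, mul_sub, Finset.sum_add_distrib, Finset.sum_sub_distrib]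
  simp only [mul_comm (θ _ x) (pd _ _ x)]
  ring

/-- A closed 2-form has vanishing antisymmetrized covariant derivative. -/
theorem covD₂_cyclic (hΓ : ∀ c a b, Γ c a b x = Γ c b a x) (hT : ∀ a b, T a b x = -T b a x)
    (a b c : Fin m) :
    covD₂ Γ T a b c x + covD₂ Γ T b c a x + covD₂ Γ T c a b x
      = pd a (T b c) x + pd b (T c a) x + pd c (T a b) x := by
  -- Each of the three derivatives has two connection terms; by the symmetry of Γ and the
  -- antisymmetry of T the six cancel in pairs around the cycle.
  have e : ∀ a b c, ∑ f, Γ f a b x * T c f x = -∑ f, Γ f b a x * T f c x := fun a b c => by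
    rw [← Finset.sum_neg_distrib]
    exact Finset.sum_congr rfl fun f _ => by rw [hΓ f a b, hT c f]; ring
  simp only [covD₂, e]
  ring

/-- The Leibniz rule: on the contracted index the connection terms of ∇v and of ∇T cancel. Used with
v = n and T = F or Y, to bring n inside ∇F and ∇Y. -/
theorem covD₁_contraction (hv : ∀ a, DifferentiableAt ℝ (v a) x)
    (hT : ∀ a b, DifferentiableAt ℝ (T a b) x) (b d : Fin m) :
    covD₁ Γ (fun d y => ∑ c, v c y * T c d y) b d x
      = ∑ c, v c x * covD₂ Γ T b c d x + ∑ c, T c d x * covDVec Γ v b c x := by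
  have h1 : ∀ c, DifferentiableAt ℝ (fun y => v c y * T c d y) x := fun c => (hv c).mul (hT c d)
  have e1 : ∑ c, v c x * ∑ f, Γ f b c x * T f d x = ∑ c, T c d x * ∑ f, Γ c b f x * v f x := by
    simp only [Finset.mul_sum]
    rw [Finset.sum_comm]
    exact Finset.sum_congr rfl fun c _ => Finset.sum_congr rfl fun f _ => by ring
  have e2 : ∑ c, v c x * ∑ f, Γ f b d x * T c f x = ∑ c, Γ c b d x * ∑ f, v f x * T f c x := by
    simp only [Finset.mul_sum]
    rw [Finset.sum_comm]
    exact Finset.sum_congr rfl fun c _ => Finset.sum_congr rfl fun f _ => by ring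
  have e3 : ∑ c, pd b (fun y => v c y * T c d y) x
      = ∑ c, T c d x * pd b (v c) x + ∑ c, v c x * pd b (T c d) x := by
    rw [← Finset.sum_add_distrib]
    exact Finset.sum_congr rfl fun c _ => by rw [pd_mul (hv c) (hT c d)]; ring
  simp only [covD₁, pd_sum h1, e3, covD₂, covDVec, mul_add, mul_sub, Finset.sum_add_distrib,
    Finset.sum_sub_distrib, e1, e2]
  ring

/-- Without torsion the connection terms of n^c∇_c T are exactly compensated by those of ∇v, so
partial derivatives may be replaced by covariant ones. -/
theorem lieD_eq_covD (hΓ : ∀ c a b, Γ c a b x = Γ c b a x) (b d : Fin m) :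
    lieD v T b d x = ∑ c, v c x * covD₂ Γ T c b d x + ∑ c, T c d x * covDVec Γ v b c x
      + ∑ c, T b c x * covDVec Γ v d c x := by
  have e : ∀ (t : Fin m → ℝ) (b : Fin m),
      ∑ c, v c x * ∑ f, Γ f c b x * t f = ∑ c, t c * ∑ f, Γ c b f x * v f x := fun t b => by
    simp only [Finset.mul_sum]
    rw [Finset.sum_comm]
    exact Finset.sum_congr rfl fun c _ => Finset.sum_congr rfl fun f _ => by rw [hΓ c f b]; ring
  simp only [lieD, vecD, covD₂, covDVec, mul_add, mul_sub, Finset.sum_add_distrib,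
    Finset.sum_sub_distrib, e (fun f => T f d x) b, e (fun f => T b f x) d]
  ring

/-- The contracted first Bianchi identity: the antisymmetric part of the Ricci tensor of a
torsion-free connection is the exterior derivative of `Γ^a_ab`. -/
theorem ricci_sub_swap (hΓ : ∀ c a b y, Γ c a b y = Γ c b a y) (b d : Fin m) :
    ricci Γ b d x - ricci Γ d b x = ∑ a, (pd b (Γ a a d) x - pd d (Γ a a b) x) := by
  have hf : ∀ c a b, Γ c a b = Γ c b a := fun c a b => funext (hΓ c a b)
  -- Both quadratic terms of the Ricci tensor and the term ∂_a Γ^a_db are symmetric in b, d; only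
  -- ∂_d Γ^a_ab contributes to the difference.
  have e : ∑ a, ∑ f, Γ a d f x * Γ f a b x = ∑ a, ∑ f, Γ a b f x * Γ f a d x := by
    rw [Finset.sum_comm]
    exact Finset.sum_congr rfl fun a _ => Finset.sum_congr rfl fun f _ => by
      rw [hΓ f d a, hΓ a f b]; ring
  have e1 : ∑ a, pd a (Γ a d b) x = ∑ a, pd a (Γ a b d) x :=
    Finset.sum_congr rfl fun a _ => by rw [hf a d b]
  have e2 : ∑ a, ∑ f, Γ a a f x * Γ f d b x = ∑ a, ∑ f, Γ a a f x * Γ f b d x :=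
    Finset.sum_congr rfl fun a _ => Finset.sum_congr rfl fun f _ => by rw [hΓ f d b]
  simp only [ricci, curvature, Finset.sum_add_distrib, Finset.sum_sub_distrib, e, e1, e2]
  ring

end CoordCalc

/-! ### Closedness of tr(A⁻¹ dA) -/

namespace CoordCalc

variable {m : ℕ} {x : EuclideanSpace ℝ (Fin m)}

/-- The logarithmic derivative `tr (A⁻¹ ∂A)` of the determinant of a matrix function is closed. -/
theorem pd_trace_inv_mul_pd_comm {ι : Type*} [Fintype ι] [DecidableEq ι]
    {M A : EuclideanSpace ℝ (Fin m) → Matrix ι ι ℝ} (h : ∀ᶠ y in nhds x, M y * A y = 1)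
    (hM : ∀ i j, ContDiffAt ℝ ∞ (fun y => M y i j) x)
    (hA : ∀ i j, ContDiffAt ℝ ∞ (fun y => A y i j) x) (b c : Fin m) :
    pd c (fun y => ∑ i, ∑ j, M y i j * pd b (fun z => A z j i) y) x
      = pd b (fun y => ∑ i, ∑ j, M y i j * pd c (fun z => A z j i) y) x := by
  have hM1 : ∀ i j, DifferentiableAt ℝ (fun y => M y i j) x := fun i j =>
    (hM i j).differentiableAt (by simp)
  have hA1 : ∀ i j, DifferentiableAt ℝ (fun y => A y i j) x := fun i j =>
    (hA i j).differentiableAt (by simp)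
  have hA2 : ∀ b i j, DifferentiableAt ℝ (pd b (fun y => A y i j)) x := fun b i j =>
    (((hA i j).fderiv_right (m := 1) (by norm_cast)).differentiableAt (by simp)).clm_apply
      (differentiableAt_const _)
  set dM : Fin m → Matrix ι ι ℝ := fun c => Matrix.of fun i j => pd c (fun y => M y i j) x with hdM
  set dA : Fin m → Matrix ι ι ℝ := fun c => Matrix.of fun i j => pd c (fun y => A y i j) x with hdA
  have hinv : A x * M x = 1 := mul_eq_one_comm.mp h.self_of_nhds
  -- The relation MA = 1 holds near x and can be differentiated; this leads to ∂M = -M ∂A M.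
  have hprod : ∀ c, dM c * A x + M x * dA c = 0 := fun c => by
    ext i k
    have h1 : ∀ j, DifferentiableAt ℝ (fun y => M y i j * A y j k) x := fun j =>
      (hM1 i j).mul (hA1 j k)
    have h2 : pd c (fun y => ∑ j, M y i j * A y j k) x = 0 := by
      rw [← pd_const (x := x) ((1 : Matrix ι ι ℝ) i k) c]
      refine pd_congr ?_ c
      filter_upwards [h] with y hy
      rw [← hy, Matrix.mul_apply]
    rw [pd_sum h1] at h2
    simp only [pd_mul (hM1 i _) (hA1 _ k), Finset.sum_add_distrib] at h2
    simpa [Matrix.mul_apply, hdM, hdA] using h2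
  have hdMe : ∀ c, dM c = -(M x * dA c * M x) := fun c => by
    have h1 : dM c * A x = -(M x * dA c) := eq_neg_of_add_eq_zero_left (hprod c)
    calc dM c = dM c * A x * M x := by rw [mul_assoc, hinv, mul_one]
      _ = _ := by rw [h1, neg_mul]
  have hexp : ∀ b c, pd c (fun y => ∑ i, ∑ j, M y i j * pd b (fun z => A z j i) y) x
      = (dM c * dA b).trace + ∑ i, ∑ j, M x i j * pd c (pd b (fun z => A z j i)) x := by
    intro b c
    have h1 : ∀ i j, DifferentiableAt ℝ (fun y => M y i j * pd b (fun z => A z j i) y) x :=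
      fun i j => (hM1 i j).mul (hA2 b j i)
    have h2 : ∀ i, DifferentiableAt ℝ (fun y => ∑ j, M y i j * pd b (fun z => A z j i) y) x :=
      fun i => DifferentiableAt.fun_sum fun j _ => h1 i j
    rw [pd_sum h2]
    simp only [pd_sum (h1 _), Matrix.trace, Matrix.diag, Matrix.mul_apply,
      ← Finset.sum_add_distrib]
    exact Finset.sum_congr rfl fun i _ => Finset.sum_congr rfl fun j _ =>
      pd_mul (hM1 i j) (hA2 b j i) c
  rw [hexp, hexp]
  congr 1
  -- The first-order part is -tr(M ∂_cA M ∂_bA), symmetric in b, c by cyclicity of the trace.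
  · rw [hdMe, hdMe, neg_mul, neg_mul, Matrix.trace_neg, Matrix.trace_neg, mul_assoc (M x * dA c),
      Matrix.trace_mul_comm, ← mul_assoc]
  · exact Finset.sum_congr rfl fun i _ => Finset.sum_congr rfl fun j _ => by
      rw [pd_comm (hA j i)]

end CoordCalc

/-! ### Smoothness and symmetries of the derived tensors -/

namespace MetricHypersurfaceData

variable {m : ℕ} {N : Type*} [TopologicalSpace N] [ChartedSpace (EuclideanSpace ℝ (Fin m)) N]
  [IsManifold (𝓡 m) ∞ N] (D : MetricHypersurfaceData m N)
  {e : OpenPartialHomeomorph N (EuclideanSpace ℝ (Fin m))} {x : EuclideanSpace ℝ (Fin m)}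

theorem contDiffOn_PC (he : e ∈ IsManifold.maximalAtlas (𝓡 m) ∞ N) (a b : Fin m) :
    ContDiffOn ℝ ∞ (D.PC e a b) e.target :=
  D.contDiffOn_inverseMatrix he (Sum.inl a) (Sum.inl b)

theorem contDiffOn_FC (he : e ∈ IsManifold.maximalAtlas (𝓡 m) ∞ N) (a b : Fin m) :
    ContDiffOn ℝ ∞ (D.FC e a b) e.target :=
  ((contDiffOn_pd e.open_target (D.contDiffOn_ellC he b) a).sub
    (contDiffOn_pd e.open_target (D.contDiffOn_ellC he a) b)).div_const 2

theorem contDiffOn_sC (he : e ∈ IsManifold.maximalAtlas (𝓡 m) ∞ N) (b : Fin m) :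
    ContDiffOn ℝ ∞ (D.sC e b) e.target :=
  ContDiffOn.sum fun a _ => (D.contDiffOn_nC he a).mul (D.contDiffOn_FC he a b)

theorem contDiffOn_Γ (he : e ∈ IsManifold.maximalAtlas (𝓡 m) ∞ N) (c a b : Fin m) :
    ContDiffOn ℝ ∞ (D.Γ e c a b) e.target := by
  have hg := fun a b f => contDiffOn_pd e.open_target (D.contDiffOn_γC he b f) a
  have hl := fun a b => contDiffOn_pd e.open_target (D.contDiffOn_ellC he b) a
  exact ((ContDiffOn.sum fun d _ => (D.contDiffOn_PC he c d).mul
    (((hg a b d).add (hg b a d)).sub (hg d a b))).div_const 2).add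
      (((D.contDiffOn_nC he c).mul ((hl a b).add (hl b a))).div_const 2)

theorem contDiffOn_UC (he : e ∈ IsManifold.maximalAtlas (𝓡 m) ∞ N) (a b : Fin m) :
    ContDiffOn ℝ ∞ (D.UC e a b) e.target := by
  have hg := fun a b => D.contDiffOn_γC he a b
  have hgd := fun a b c => contDiffOn_pd e.open_target (D.contDiffOn_γC he b c) a
  have hl := fun a => D.contDiffOn_ellC he a
  have hn := fun a => D.contDiffOn_nC he a
  have hnd := fun a b => contDiffOn_pd e.open_target (D.contDiffOn_nC he b) a
  have h2 := fun a => contDiffOn_pd e.open_target (D.contDiffOn_n2C he) a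
  exact ((((ContDiffOn.sum fun c _ => (hn c).mul (hgd c a b)).add
    (ContDiffOn.sum fun c _ => (hg c b).mul (hnd a c))).add
    (ContDiffOn.sum fun c _ => (hg a c).mul (hnd b c))).div_const 2).add
      ((((hl a).mul (h2 b)).add ((hl b).mul (h2 a))).div_const 2)

theorem FC_antisymm (a b : Fin m) (y : EuclideanSpace ℝ (Fin m)) :
    D.FC e a b y = -D.FC e b a y := by
  simp only [FC]
  ring

theorem sum_nC_FC (b : Fin m) : ∑ a, D.nC e a x * D.FC e b a x = -D.sC e b x := by
  rw [sC, ← Finset.sum_neg_distrib]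
  exact Finset.sum_congr rfl fun a _ => by rw [D.FC_antisymm b a]; ring

/-- This is F(n,n), and F is antisymmetric. -/
theorem sum_nC_sC : ∑ a, D.nC e a x * D.sC e a x = 0 := by
  have h : ∑ a, D.nC e a x * D.sC e a x = -∑ a, D.nC e a x * D.sC e a x := by
    simp only [sC, Finset.mul_sum]
    nth_rw 1 [Finset.sum_comm]
    simp only [← Finset.sum_neg_distrib]
    exact Finset.sum_congr rfl fun a _ => Finset.sum_congr rfl fun b _ => by
      rw [D.FC_antisymm a b]; ring
  linarith

theorem UC_symm (a b : Fin m) (y : EuclideanSpace ℝ (Fin m)) : D.UC e a b y = D.UC e b a y := by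
  have hs : D.γC e a b = D.γC e b a := funext fun y => D.γC_symm a b y
  simp only [UC, lieD, vecD, symPart, hs, D.γC_symm a, D.γC_symm _ b]
  ring

/-! ### Covariant derivatives of ℓ and n -/

/-- `∇_a ℓ_b = F_ab - ℓ₂ U_ab` -/
theorem covD₁_ellC (he : e ∈ IsManifold.maximalAtlas (𝓡 m) ∞ N) (hx : x ∈ e.target)
    (a b : Fin m) :
    covD₁ (D.Γ e) (D.ellC e) a b x = D.FC e a b x - D.ell2C e x * D.UC e a b x := by
  rw [covD₁, D.ellC_Γ he hx, FC]
  ring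

/-- The derivative of `ℓ_a n^a + n₂ ℓ₂ = 1`. -/
theorem pd_ellC_nC (he : e ∈ IsManifold.maximalAtlas (𝓡 m) ∞ N) (hx : x ∈ e.target) (a : Fin m) :
    ∑ c, pd a (D.ellC e c) x * D.nC e c x + ∑ c, D.ellC e c x * pd a (D.nC e c) x
      + (pd a (D.n2C e) x * D.ell2C e x + D.n2C e x * pd a (D.ell2C e) x) = 0 := by
  have hl := fun c => differentiableAt_of_contDiffOn (D.contDiffOn_ellC he c) hx
  have hn := fun c => differentiableAt_of_contDiffOn (D.contDiffOn_nC he c) hx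
  have h2 := differentiableAt_of_contDiffOn (D.contDiffOn_n2C he) hx
  have hl2 := differentiableAt_of_contDiffOn (D.contDiffOn_ell2C he) hx
  have hp : ∀ c, DifferentiableAt ℝ (fun y => D.ellC e c y * D.nC e c y) x := fun c =>
    (hl c).mul (hn c)
  have h : pd a (fun y => ∑ c, D.ellC e c y * D.nC e c y + D.n2C e y * D.ell2C e y) x = 0 := by
    rw [← pd_const (x := x) 1 a]
    refine pd_congr ?_ a
    filter_upwards [e.open_target.mem_nhds hx] with y hy
    exact D.ellC_nC he hy
  have h3 : DifferentiableAt ℝ (fun y => D.n2C e y * D.ell2C e y) x := h2.mul hl2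
  rw [pd_add (DifferentiableAt.fun_sum fun c _ => hp c) h3, pd_sum hp,
    pd_mul h2 hl2] at h
  simpa only [pd_mul (hl _) (hn _), Finset.sum_add_distrib] using h

/-- `ℓ_c ∇_a n^c` -/
theorem ellC_covDVec_nC (he : e ∈ IsManifold.maximalAtlas (𝓡 m) ∞ N) (hx : x ∈ e.target)
    (a : Fin m) :
    ∑ c, D.ellC e c x * covDVec (D.Γ e) (D.nC e) a c x
      = D.sC e a x + D.ell2C e x * ∑ c, D.nC e c x * D.UC e a c x
        - pd a (D.n2C e) x * D.ell2C e x - D.n2C e x * pd a (D.ell2C e) x := by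
  have h := D.pd_ellC_nC he hx a
  have e1 : ∑ c, D.ellC e c x * ∑ f, D.Γ e c a f x * D.nC e f x
      = ∑ f, D.nC e f x * ∑ c, D.Γ e c a f x * D.ellC e c x := by
    simp only [Finset.mul_sum]
    rw [Finset.sum_comm]
    exact Finset.sum_congr rfl fun c _ => Finset.sum_congr rfl fun f _ => by ring
  have e2 : ∑ f, D.nC e f x * ∑ c, D.Γ e c a f x * D.ellC e c x
      = ∑ c, pd a (D.ellC e c) x * D.nC e c x - ∑ f, D.nC e f x * D.FC e a f x
        + D.ell2C e x * ∑ c, D.nC e c x * D.UC e a c x := by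
    rw [Finset.mul_sum, ← Finset.sum_sub_distrib, ← Finset.sum_add_distrib]
    exact Finset.sum_congr rfl fun f _ => by rw [D.ellC_Γ he hx, FC]; ring
  simp only [covDVec, mul_add, Finset.sum_add_distrib, e1, e2, D.sum_nC_FC]
  linarith

/-- `γ_cb ∇_a n^c` -/
theorem γC_covDVec_nC (he : e ∈ IsManifold.maximalAtlas (𝓡 m) ∞ N) (hx : x ∈ e.target)
    (a b : Fin m) :
    ∑ c, D.γC e c b x * covDVec (D.Γ e) (D.nC e) a c x
      = D.UC e a b x - D.n2C e x * D.FC e a b x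
        + (∑ c, D.nC e c x * D.UC e a c x - pd a (D.n2C e) x) * D.ellC e b x := by
  have h := D.pd_γC_nC he hx a b
  have h1 := D.ellC_nC he hx
  have hl := D.covD₁_ellC he hx a b
  have e1 : ∑ c, D.γC e c b x * ∑ f, D.Γ e c a f x * D.nC e f x
      = ∑ f, D.nC e f x * ∑ c, D.Γ e c a f x * D.γC e c b x := by
    simp only [Finset.mul_sum]
    rw [Finset.sum_comm]
    exact Finset.sum_congr rfl fun c _ => Finset.sum_congr rfl fun f _ => by ring
  have hγ : ∀ f, ∑ c, D.Γ e c a f x * D.γC e c b x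
      = pd a (D.γC e f b) x - ∑ c, D.Γ e c a b x * D.γC e f c x
        + D.UC e a f x * D.ellC e b x + D.UC e a b x * D.ellC e f x := fun f => by
    have := (D.Γ_spec he hx).2.1 a f b
    rw [covD₂] at this
    linarith
  have e2 : ∑ f, D.nC e f x * ∑ c, D.Γ e c a b x * D.γC e f c x
      = -D.n2C e x * ∑ c, D.Γ e c a b x * D.ellC e c x := by
    simp only [Finset.mul_sum]
    rw [Finset.sum_comm]
    refine Finset.sum_congr rfl fun c _ => ?_
    have := D.γC_nC he hx c
    calc ∑ f, D.nC e f x * (D.Γ e c a b x * D.γC e f c x)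
        = D.Γ e c a b x * ∑ f, D.γC e f c x * D.nC e f x := by
          rw [Finset.mul_sum]
          exact Finset.sum_congr rfl fun f _ => by ring
      _ = _ := by rw [eq_neg_of_add_eq_zero_left this]; ring
  have e3 : ∑ f, D.nC e f x * ∑ c, D.Γ e c a f x * D.γC e c b x
      = ∑ f, pd a (D.γC e f b) x * D.nC e f x
        - ∑ f, D.nC e f x * ∑ c, D.Γ e c a b x * D.γC e f c x
        + (∑ f, D.nC e f x * D.UC e a f x) * D.ellC e b x
        + D.UC e a b x * ∑ f, D.ellC e f x * D.nC e f x := by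
    rw [Finset.sum_mul, Finset.mul_sum, ← Finset.sum_sub_distrib, ← Finset.sum_add_distrib,
      ← Finset.sum_add_distrib]
    exact Finset.sum_congr rfl fun f _ => by rw [hγ f]; ring
  rw [covD₁] at hl
  simp only [covDVec, mul_add, Finset.sum_add_distrib, e1, e3, e2] at h ⊢
  -- The coefficient of U_ab is ℓ(n) + n₂ℓ₂ = 1: the first part comes from ∇γ, the second from n₂∇ℓ.
  linear_combination h + D.UC e a b x * h1 - D.n2C e x * hl

/-- `U(n, ·) = - n₂ s + (1/2) d n₂ + (1/2) n₂² d ℓ₂` -/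
theorem sum_nC_UC (he : e ∈ IsManifold.maximalAtlas (𝓡 m) ∞ N) (hx : x ∈ e.target) (a : Fin m) :
    ∑ c, D.nC e c x * D.UC e a c x = -D.n2C e x * D.sC e a x + pd a (D.n2C e) x / 2
      + D.n2C e x ^ 2 * pd a (D.ell2C e) x / 2 := by
  have h1 := D.ellC_covDVec_nC he hx a
  have hn := D.ellC_nC he hx
  have e1 : ∑ b, D.nC e b x * ∑ c, D.γC e c b x * covDVec (D.Γ e) (D.nC e) a c x
      = -D.n2C e x * ∑ c, D.ellC e c x * covDVec (D.Γ e) (D.nC e) a c x := by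
    simp only [Finset.mul_sum]
    rw [Finset.sum_comm]
    refine Finset.sum_congr rfl fun c _ => ?_
    have := D.γC_nC he hx c
    calc ∑ b, D.nC e b x * (D.γC e c b x * covDVec (D.Γ e) (D.nC e) a c x)
        = (∑ b, D.γC e b c x * D.nC e b x) * covDVec (D.Γ e) (D.nC e) a c x := by
          rw [Finset.sum_mul]
          exact Finset.sum_congr rfl fun f _ => by rw [D.γC_symm c]; ring
      _ = _ := by rw [eq_neg_of_add_eq_zero_left this]; ring
  have e2 : ∑ b, D.nC e b x * ∑ c, D.γC e c b x * covDVec (D.Γ e) (D.nC e) a c x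
      = ∑ b, D.nC e b x * D.UC e a b x - D.n2C e x * ∑ b, D.nC e b x * D.FC e a b x
        + (∑ c, D.nC e c x * D.UC e a c x - pd a (D.n2C e) x)
          * ∑ b, D.ellC e b x * D.nC e b x := by
    rw [Finset.mul_sum, Finset.mul_sum, ← Finset.sum_sub_distrib, ← Finset.sum_add_distrib]
    exact Finset.sum_congr rfl fun b _ => by rw [D.γC_covDVec_nC he hx]; ring
  rw [D.sum_nC_FC] at e2
  rw [e2, h1] at e1
  -- Evaluating n^b γ_cb ∇_a n^c in two ways gives a linear equation for U(n,·). The terms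
  -- n₂ℓ₂U(n,·) occur on both sides and drop out, leaving 2U(n,·), whence the factor 1/2.
  linear_combination e1 / 2 - (∑ c, D.nC e c x * D.UC e a c x - pd a (D.n2C e) x) / 2 * hn

/-- `∇_a n^c = n^c (s_a - n₂ ∇_a ℓ₂) + P^cb (U_ab - n₂ F_ab)` -/
theorem covDVec_nC (he : e ∈ IsManifold.maximalAtlas (𝓡 m) ∞ N) (hx : x ∈ e.target)
    (a c : Fin m) :
    covDVec (D.Γ e) (D.nC e) a c x = D.nC e c x * (D.sC e a x - D.n2C e x * pd a (D.ell2C e) x)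
      + ∑ b, D.PC e c b x * (D.UC e a b x - D.n2C e x * D.FC e a b x) := by
  have h1 := D.ellC_covDVec_nC he hx a
  have hP := D.PC_ellC he hx c
  -- A vector is recovered from its pairings with γ and ℓ, since δ^c_f = P^cb γ_bf + n^c ℓ_f.
  have e1 : covDVec (D.Γ e) (D.nC e) a c x
      = ∑ b, D.PC e c b x * ∑ f, D.γC e f b x * covDVec (D.Γ e) (D.nC e) a f x
        + D.nC e c x * ∑ f, D.ellC e f x * covDVec (D.Γ e) (D.nC e) a f x := by
    have : covDVec (D.Γ e) (D.nC e) a c x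
        = ∑ f, (if c = f then 1 else 0) * covDVec (D.Γ e) (D.nC e) a f x := by simp
    rw [this]
    simp only [Finset.mul_sum]
    rw [Finset.sum_comm, ← Finset.sum_add_distrib]
    refine Finset.sum_congr rfl fun f _ => ?_
    rw [← D.PC_γC he hx c f, add_mul, Finset.sum_mul]
    congr 1
    · exact Finset.sum_congr rfl fun b _ => by rw [D.γC_symm f]; ring
    · ring
  have e2 : ∑ b, D.PC e c b x * ∑ f, D.γC e f b x * covDVec (D.Γ e) (D.nC e) a f x
      = ∑ b, D.PC e c b x * (D.UC e a b x - D.n2C e x * D.FC e a b x)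
        + (∑ c, D.nC e c x * D.UC e a c x - pd a (D.n2C e) x)
          * ∑ b, D.PC e c b x * D.ellC e b x := by
    rw [Finset.mul_sum, ← Finset.sum_add_distrib]
    exact Finset.sum_congr rfl fun b _ => by rw [D.γC_covDVec_nC he hx]; ring
  rw [e1, e2, h1]
  -- By Pℓ = -ℓ₂n the terms containing U(n,·) and dn₂ cancel between the two pairings.
  linear_combination (∑ c, D.nC e c x * D.UC e a c x - pd a (D.n2C e) x) * hP

/-! ### The contraction of the curvature with ℓ -/

/-- `ℓ_a R^a_bcd = ∇_b F_cd + U_db ∇_c ℓ₂ - U_cb ∇_d ℓ₂ - ℓ₂ (∇_d U_cb - ∇_c U_db)` -/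
theorem ellC_riem (he : e ∈ IsManifold.maximalAtlas (𝓡 m) ∞ N) (hx : x ∈ e.target)
    (b c d : Fin m) :
    ∑ a, D.ellC e a x * D.riem e a b c d x
      = D.nabla₂ e (D.FC e) b c d x + D.UC e d b x * pd c (D.ell2C e) x
        - D.UC e c b x * pd d (D.ell2C e) x
        - D.ell2C e x * (D.nabla₂ e (D.UC e) d c b x - D.nabla₂ e (D.UC e) c d b x) := by
  have hnh := e.open_target.mem_nhds hx
  have hΓs : ∀ c a b y, D.Γ e c a b y = D.Γ e c b a y := fun c a b y => D.Γ_symm c a b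
  have hl : ∀ a, ContDiffAt ℝ ∞ (D.ellC e a) x := fun a => (D.contDiffOn_ellC he a).contDiffAt hnh
  have hld : ∀ a b, DifferentiableAt ℝ (pd a (D.ellC e b)) x := fun a b =>
    differentiableAt_of_contDiffOn (contDiffOn_pd e.open_target (D.contDiffOn_ellC he b) a) hx
  have hF : ∀ a b, DifferentiableAt ℝ (D.FC e a b) x := fun a b =>
    differentiableAt_of_contDiffOn (D.contDiffOn_FC he a b) hx
  have hU : ∀ a b, DifferentiableAt ℝ (D.UC e a b) x := fun a b =>
    differentiableAt_of_contDiffOn (D.contDiffOn_UC he a b) hx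
  have hl2 := differentiableAt_of_contDiffOn (D.contDiffOn_ell2C he) hx
  have hR := covD₂_covD₁_sub_swap hΓs
    (fun c a b => differentiableAt_of_contDiffOn (D.contDiffOn_Γ he c a b) hx) hl b c d
  have hcov : ∀ᶠ y in nhds x, ∀ b c, covD₁ (D.Γ e) (D.ellC e) b c y
      = D.FC e b c y - D.ell2C e y * D.UC e b c y := by
    filter_upwards [hnh] with y hy b c using D.covD₁_ellC he hy b c
  rw [covD₂_congr hcov, covD₂_congr hcov, covD₂_sub_mul hF hU hl2, covD₂_sub_mul hF hU hl2] at hR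
  -- Since F = dℓ/2 is closed, the cyclic sum of ∇F vanishes; with the antisymmetry of F this turns
  -- ∇_c F_db - ∇_d F_cb into -∇_b F_cd.
  have hcyc := covD₂_cyclic (T := D.FC e) (fun c a b => hΓs c a b x) (fun a b => D.FC_antisymm a b x) b c d
  have hdF : ∀ a b c, pd a (D.FC e b c) x
      = (pd a (pd b (D.ellC e c)) x - pd a (pd c (D.ellC e b)) x) / 2 := fun a b c => by
    change pd a (fun y => (pd b (D.ellC e c) y - pd c (D.ellC e b) y) / 2) x = _
    have h1 : DifferentiableAt ℝ (fun y => pd b (D.ellC e c) y - pd c (D.ellC e b) y) x :=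
      (hld b c).sub (hld c b)
    rw [pd_div_const h1, pd_sub (hld b c) (hld c b)]
  rw [hdF, hdF, hdF, pd_comm (hl d) b c, pd_comm (hl b) c d, pd_comm (hl c) d b] at hcyc
  have hFa : covD₂ (D.Γ e) (D.FC e) d b c x = -covD₂ (D.Γ e) (D.FC e) d c b x := by
    have h0 : D.FC e b c = fun y => -D.FC e c b y := funext fun y => D.FC_antisymm b c y
    have h1 : pd d (D.FC e b c) x = -pd d (D.FC e c b) x := by
      rw [h0]; simp [pd]
    have h2 : ∑ f, D.Γ e f d b x * D.FC e f c x = -∑ f, D.Γ e f d b x * D.FC e c f x := by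
      rw [← Finset.sum_neg_distrib]
      exact Finset.sum_congr rfl fun f _ => by rw [D.FC_antisymm f c]; ring
    have h3 : ∑ f, D.Γ e f d c x * D.FC e b f x = -∑ f, D.Γ e f d c x * D.FC e f b x := by
      rw [← Finset.sum_neg_distrib]
      exact Finset.sum_congr rfl fun f _ => by rw [D.FC_antisymm b f]; ring
    rw [covD₂, covD₂, h1, h2, h3]
    ring
  simp only [riem, nabla₂]
  linarith

/-! ### The antisymmetric part of the Ricci tensor -/

/-- `Γ^a_ab = (1/2) tr (𝓐⁻¹ ∂_b 𝓐) + s_b - (1/2) n₂ ∂_b ℓ₂` -/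
theorem sum_Γ (he : e ∈ IsManifold.maximalAtlas (𝓡 m) ∞ N) (hx : x ∈ e.target) (b : Fin m) :
    ∑ a, D.Γ e a a b x = (∑ i, ∑ j, D.inverseMatrix e x i j *
        pd b (fun y => D.ambientMatrix e y j i) x) / 2
      + (D.sC e b x - D.n2C e x * pd b (D.ell2C e) x / 2) := by
  have hs : ∀ a b, D.γC e a b = D.γC e b a := fun a b => funext fun y => D.γC_symm a b y
  -- By the symmetry of P, the two derivatives of γ along summed directions cancel.
  have e1 : ∑ a, ∑ d, D.PC e a d x *
        (pd a (D.γC e b d) x + pd b (D.γC e a d) x - pd d (D.γC e a b) x)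
      = ∑ a, ∑ d, D.PC e a d x * pd b (D.γC e d a) x := by
    have e2 : ∑ a, ∑ d, D.PC e a d x * pd d (D.γC e a b) x
        = ∑ a, ∑ d, D.PC e a d x * pd a (D.γC e b d) x := by
      rw [Finset.sum_comm]
      exact Finset.sum_congr rfl fun a _ => Finset.sum_congr rfl fun d _ => by
        rw [D.PC_symm he hx d a, hs d b]
    simp only [mul_add, mul_sub, Finset.sum_add_distrib, Finset.sum_sub_distrib, e2]
    rw [add_sub_cancel_left]
    exact Finset.sum_congr rfl fun a _ => Finset.sum_congr rfl fun d _ => by rw [hs a d]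
  -- The two off-diagonal blocks each contribute n^a ∂_b ℓ_a. The corner block contributes n₂ ∂_b
  -- ℓ₂, which is absent from Γ^a_ab; this is why half of it is subtracted in the statement.
  have e3 : ∑ i, ∑ j, D.inverseMatrix e x i j * pd b (fun y => D.ambientMatrix e y j i) x
      = ∑ a, ∑ d, D.PC e a d x * pd b (D.γC e d a) x
        + 2 * ∑ a, D.nC e a x * pd b (D.ellC e a) x + D.n2C e x * pd b (D.ell2C e) x := by
    simp only [Fintype.sum_sum_type, Finset.univ_unique, Finset.sum_singleton,
      Finset.sum_add_distrib, inverseMatrix, ambientMatrix, Matrix.of_apply, Sum.elim_inl,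
      Sum.elim_inr]
    change _ + ∑ a, D.nC e a x * pd b (D.ellC e a) x
      + (∑ a, D.nC e a x * pd b (D.ellC e a) x + D.n2C e x * pd b (D.ell2C e) x) = _
    change ∑ a, ∑ d, D.PC e a d x * pd b (D.γC e d a) x + _ + _ = _
    ring
  have e4 : ∑ a, D.nC e a x * (pd a (D.ellC e b) x + pd b (D.ellC e a) x) / 2
      = D.sC e b x + ∑ a, D.nC e a x * pd b (D.ellC e a) x := by
    rw [sC, ← Finset.sum_add_distrib]
    exact Finset.sum_congr rfl fun a _ => by rw [FC]; ring
  simp only [Γ, Finset.sum_add_distrib, e4, ← Finset.sum_div, e1, e3]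
  ring

/-- `R_[bd] = ∇_[b s_d] - (1/2) ∇_[b n₂ ∇_d] ℓ₂` -/
theorem ric_sub_swap (he : e ∈ IsManifold.maximalAtlas (𝓡 m) ∞ N) (hx : x ∈ e.target)
    (b d : Fin m) :
    D.ric e b d x - D.ric e d b x = pd b (D.sC e d) x - pd d (D.sC e b) x
      - (pd b (D.n2C e) x * pd d (D.ell2C e) x - pd d (D.n2C e) x * pd b (D.ell2C e) x) / 2 := by
  have hnh := e.open_target.mem_nhds hx
  have hi : ∀ i j, ContDiffAt ℝ ∞ (fun y => D.inverseMatrix e y i j) x := fun i j =>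
    (D.contDiffOn_inverseMatrix he i j).contDiffAt hnh
  have ha : ∀ i j, ContDiffAt ℝ ∞ (fun y => D.ambientMatrix e y i j) x := fun i j =>
    (D.contDiffOn_ambientMatrix he i j).contDiffAt hnh
  have had : ∀ b i j, DifferentiableAt ℝ (pd b (fun y => D.ambientMatrix e y i j)) x :=
    fun b i j => differentiableAt_of_contDiffOn
      (contDiffOn_pd e.open_target (D.contDiffOn_ambientMatrix he i j) b) hx
  have hs := fun b => differentiableAt_of_contDiffOn (D.contDiffOn_sC he b) hx
  have h2 := differentiableAt_of_contDiffOn (D.contDiffOn_n2C he) hx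
  have hl2 : ∀ b, DifferentiableAt ℝ (pd b (D.ell2C e)) x := fun b =>
    differentiableAt_of_contDiffOn (contDiffOn_pd e.open_target (D.contDiffOn_ell2C he) b) hx
  have hΓ := fun c a b => differentiableAt_of_contDiffOn (D.contDiffOn_Γ he c a b) hx
  have hT : ∀ b, DifferentiableAt ℝ (fun y => ∑ i, ∑ j, D.inverseMatrix e y i j *
      pd b (fun z => D.ambientMatrix e z j i) y) x := fun b =>
    DifferentiableAt.fun_sum fun i _ => DifferentiableAt.fun_sum fun j _ =>
      ((hi i j).differentiableAt (by simp)).mul (had b j i)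
  have hn : ∀ b, DifferentiableAt ℝ (fun y => D.n2C e y * pd b (D.ell2C e) y) x := fun b =>
    h2.mul (hl2 b)
  have hn' : ∀ b, DifferentiableAt ℝ (fun y => D.n2C e y * pd b (D.ell2C e) y / 2) x := fun b => by
    simpa only [div_eq_mul_inv] using (hn b).mul_const 2⁻¹
  have hT' : ∀ b, DifferentiableAt ℝ (fun y => (∑ i, ∑ j, D.inverseMatrix e y i j *
      pd b (fun z => D.ambientMatrix e z j i) y) / 2) x := fun b => by
    simpa only [div_eq_mul_inv] using (hT b).mul_const 2⁻¹
  have hns : ∀ b, DifferentiableAt ℝ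
      (fun y => D.sC e b y - D.n2C e y * pd b (D.ell2C e) y / 2) x := fun b => (hs b).sub (hn' b)
  have key : ∀ c b, ∑ a, pd c (D.Γ e a a b) x
      = pd c (fun y => ∑ i, ∑ j, D.inverseMatrix e y i j *
          pd b (fun z => D.ambientMatrix e z j i) y) x / 2
        + (pd c (D.sC e b) x - (pd c (D.n2C e) x * pd b (D.ell2C e) x
          + D.n2C e x * pd c (pd b (D.ell2C e)) x) / 2) := by
    intro c b
    rw [← pd_sum fun a => hΓ a a b, ← pd_mul h2 (hl2 b), ← pd_div_const (hn b),
      ← pd_sub (hs b) (hn' b), ← pd_div_const (hT b),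
      ← pd_add (hT' b) (hns b)]
    refine pd_congr ?_ c
    filter_upwards [hnh] with y hy
    exact D.sum_Γ he hy b
  -- In the curl of Γ^a_ab the trace part and the second derivatives of ℓ₂ drop out, leaving ds -
  -- (1/2) dn₂ ∧ dℓ₂.
  rw [ric, ric, ricci_sub_swap (Γ := D.Γ e) fun c a b y => D.Γ_symm c a b, Finset.sum_sub_distrib,
    key, key,
    pd_trace_inv_mul_pd_comm (x := x) (by
      filter_upwards [hnh] with y hy using D.inverse_mul_ambient he hy) hi ha b d,
    pd_comm ((D.contDiffOn_ell2C he).contDiffAt hnh) b d]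
  ring

end MetricHypersurfaceData

/-! ### Contractions with n and P -/

namespace MetricHypersurfaceData

variable {m : ℕ} {N : Type*} [TopologicalSpace N] [ChartedSpace (EuclideanSpace ℝ (Fin m)) N]
  [IsManifold (𝓡 m) ∞ N] (D : MetricHypersurfaceData m N)
  {e : OpenPartialHomeomorph N (EuclideanSpace ℝ (Fin m))} {x : EuclideanSpace ℝ (Fin m)}

/-- `θ_c ∇_a n^c` -/
theorem sum_mul_covDVec_nC (he : e ∈ IsManifold.maximalAtlas (𝓡 m) ∞ N) (hx : x ∈ e.target)
    (θ : Fin m → ℝ) (d : Fin m) :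
    ∑ c, θ c * covDVec (D.Γ e) (D.nC e) d c x
      = (∑ c, D.nC e c x * θ c) * (D.sC e d x - D.n2C e x * pd d (D.ell2C e) x)
        + ∑ a, ∑ c, D.PC e a c x * (θ c * (D.UC e d a x - D.n2C e x * D.FC e d a x)) := by
  rw [Finset.sum_comm, Finset.sum_mul, ← Finset.sum_add_distrib]
  refine Finset.sum_congr rfl fun c _ => ?_
  rw [D.covDVec_nC he hx, mul_add, Finset.mul_sum]
  congr 1
  · ring
  · exact Finset.sum_congr rfl fun a _ => by rw [D.PC_symm he hx a c]; ring

/-- The contraction with `P` only depends on the symmetric part. -/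
theorem sum_PC_congr (he : e ∈ IsManifold.maximalAtlas (𝓡 m) ∞ N) (hx : x ∈ e.target)
    {G H : Fin m → Fin m → ℝ} (h : ∀ a c, G a c + G c a = H a c + H c a) :
    ∑ a, ∑ c, D.PC e a c x * G a c = ∑ a, ∑ c, D.PC e a c x * H a c := by
  have hs : ∀ G : Fin m → Fin m → ℝ, ∑ a, ∑ c, D.PC e a c x * G a c
      = (∑ a, ∑ c, D.PC e a c x * (G a c + G c a)) / 2 := fun G => by
    have : ∑ a, ∑ c, D.PC e a c x * G a c = ∑ a, ∑ c, D.PC e a c x * G c a := by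
      rw [Finset.sum_comm]
      exact Finset.sum_congr rfl fun a _ => Finset.sum_congr rfl fun c _ => by
        rw [D.PC_symm he hx]
    simp only [mul_add, Finset.sum_add_distrib]
    linarith
  rw [hs G, hs H]
  simp only [h]

/-- `n^c ∇_b F_cd = ∇_b s_d - F_cd ∇_b n^c` -/
theorem sum_nC_nabla_FC (he : e ∈ IsManifold.maximalAtlas (𝓡 m) ∞ N) (hx : x ∈ e.target)
    (b d : Fin m) :
    ∑ c, D.nC e c x * D.nabla₂ e (D.FC e) b c d x = D.nabla₁ e (D.sC e) b d x
      - ∑ c, D.FC e c d x * covDVec (D.Γ e) (D.nC e) b c x := by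
  have h : covD₁ (D.Γ e) (D.sC e) b d x = _ := covD₁_contraction
    (fun a => differentiableAt_of_contDiffOn (D.contDiffOn_nC he a) hx)
    (fun a b => differentiableAt_of_contDiffOn (D.contDiffOn_FC he a b) hx) b d
  simp only [nabla₁, nabla₂, h]
  ring

end MetricHypersurfaceData

/-! ### The contraction of A with n -/

namespace HypersurfaceData

variable {m : ℕ} {N : Type*} [TopologicalSpace N] [ChartedSpace (EuclideanSpace ℝ (Fin m)) N]
  [IsManifold (𝓡 m) ∞ N] (D : HypersurfaceData m N)
  {e : OpenPartialHomeomorph N (EuclideanSpace ℝ (Fin m))} {x : EuclideanSpace ℝ (Fin m)}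

theorem YC_symm (a b : Fin m) (y : EuclideanSpace ℝ (Fin m)) : D.YC e a b y = D.YC e b a y :=
  D.Y_symm _ _ _

theorem contDiffOn_YC (he : e ∈ IsManifold.maximalAtlas (𝓡 m) ∞ N) (a b : Fin m) :
    ContDiffOn ℝ ∞ (D.YC e a b) e.target :=
  MetricHypersurfaceData.contDiffOn_pair D.Y_smooth he a b

theorem contDiffOn_rC (he : e ∈ IsManifold.maximalAtlas (𝓡 m) ∞ N) (b : Fin m) :
    ContDiffOn ℝ ∞ (D.rC e b) e.target :=
  ContDiffOn.sum fun a _ => (D.contDiffOn_nC he a).mul (D.contDiffOn_YC he a b)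

theorem sum_nC_YC (b : Fin m) : ∑ a, D.nC e a x * D.YC e b a x = D.rC e b x := by
  simp only [rC, D.YC_symm b]

theorem sum_nC_rC : ∑ a, D.nC e a x * D.rC e a x = -D.κ e x := by
  rw [κ, neg_neg, Finset.sum_comm]
  simp only [rC, Finset.mul_sum]
  exact Finset.sum_congr rfl fun a _ => Finset.sum_congr rfl fun b _ => by ring

/-- `n^c ∇_b Y_cd = ∇_b r_d - Y_cd ∇_b n^c` -/
theorem sum_nC_nabla_YC (he : e ∈ IsManifold.maximalAtlas (𝓡 m) ∞ N) (hx : x ∈ e.target)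
    (b d : Fin m) :
    ∑ c, D.nC e c x * D.nabla₂ e (D.YC e) b c d x = D.nabla₁ e (D.rC e) b d x
      - ∑ c, D.YC e c d x * covDVec (D.Γ e) (D.nC e) b c x := by
  have h : covD₁ (D.Γ e) (D.rC e) b d x = _ := covD₁_contraction
    (fun a => differentiableAt_of_contDiffOn (D.contDiffOn_nC he a) hx)
    (fun a b => differentiableAt_of_contDiffOn (D.contDiffOn_YC he a b) hx) b d
  simp only [MetricHypersurfaceData.nabla₁, MetricHypersurfaceData.nabla₂, h]
  ring

theorem nabla_sC_add_rC (he : e ∈ IsManifold.maximalAtlas (𝓡 m) ∞ N) (hx : x ∈ e.target)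
    (b d : Fin m) :
    D.nabla₁ e (fun a y => D.sC e a y + D.rC e a y) b d x
      = D.nabla₁ e (D.sC e) b d x + D.nabla₁ e (D.rC e) b d x :=
  covD₁_add (fun a => differentiableAt_of_contDiffOn (D.contDiffOn_sC he a) hx)
    (fun a => differentiableAt_of_contDiffOn (D.contDiffOn_rC he a) hx) b d

theorem nabla_sC_add_two_rC (he : e ∈ IsManifold.maximalAtlas (𝓡 m) ∞ N) (hx : x ∈ e.target)
    (b d : Fin m) :
    D.nabla₁ e (fun a y => D.sC e a y + 2 * D.rC e a y) b d x
      = D.nabla₁ e (D.sC e) b d x + 2 * D.nabla₁ e (D.rC e) b d x := by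
  have hr := fun a => differentiableAt_of_contDiffOn (D.contDiffOn_rC he a) hx
  refine (covD₁_add (fun a => differentiableAt_of_contDiffOn (D.contDiffOn_sC he a) hx)
    (fun a => (hr a).const_mul 2) b d).trans ?_
  rw [covD₁_const_mul hr]
  rfl

/-- Inserting `ellC_riem` cancels all terms ℓ₂∇U and halves the products of U with dℓ₂. The bracket
in A becomes 2(r - s) + n₂dℓ₂ because F(·,n) = -s. -/
theorem A_eq (he : e ∈ IsManifold.maximalAtlas (𝓡 m) ∞ N) (hx : x ∈ e.target) (b c d : Fin m) :
    D.A e b c d x = D.nabla₂ e (D.FC e) b c d x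
      + (D.UC e b d x * pd c (D.ell2C e) x - D.UC e b c x * pd d (D.ell2C e) x) / 2
      + (D.nabla₂ e (D.YC e) d c b x - D.nabla₂ e (D.YC e) c d b x)
      + (D.YC e b d x * (2 * (D.rC e c x - D.sC e c x) + D.n2C e x * pd c (D.ell2C e) x)
        - D.YC e b c x * (2 * (D.rC e d x - D.sC e d x) + D.n2C e x * pd d (D.ell2C e) x)) / 2 := by
  have h : ∀ c, ∑ f, 2 * (D.FC e c f x + D.YC e c f x) * D.nC e f x
      = 2 * (D.rC e c x - D.sC e c x) := fun c => by
    rw [← D.sum_nC_YC, ← neg_neg (D.sC e c x), ← D.sum_nC_FC, sub_neg_eq_add,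
      ← Finset.sum_add_distrib, Finset.mul_sum]
    exact Finset.sum_congr rfl fun f _ => by ring
  simp only [A, altPart, h, D.ellC_riem he hx, D.UC_symm d b, D.UC_symm c b]
  ring

/-- n is moved inside ∇_b F and ∇_d Y, but n^c ∇_c Y_db is left alone: after symmetrization it is
the transport term of £_n Y. -/
theorem sum_nC_A (he : e ∈ IsManifold.maximalAtlas (𝓡 m) ∞ N) (hx : x ∈ e.target) (b d : Fin m) :
    ∑ c, D.nC e c x * D.A e b c d x = D.nabla₁ e (D.sC e) b d x
      - ∑ c, D.FC e c d x * covDVec (D.Γ e) (D.nC e) b c x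
      + (D.UC e b d x * vecD (D.nC e) (D.ell2C e) x
        - (∑ c, D.nC e c x * D.UC e b c x) * pd d (D.ell2C e) x) / 2
      + (D.nabla₁ e (D.rC e) d b x - ∑ c, D.YC e c b x * covDVec (D.Γ e) (D.nC e) d c x
        - ∑ c, D.nC e c x * D.nabla₂ e (D.YC e) c d b x)
      + (D.YC e b d x * (-2 * D.κ e x + D.n2C e x * vecD (D.nC e) (D.ell2C e) x)
        - D.rC e b x *
          (2 * (D.rC e d x - D.sC e d x) + D.n2C e x * pd d (D.ell2C e) x)) / 2 := by
  have h : ∑ c, D.nC e c x * D.A e b c d x = ∑ c, D.nC e c x * D.nabla₂ e (D.FC e) b c d x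
      + (D.UC e b d x * ∑ c, D.nC e c x * pd c (D.ell2C e) x
        - (∑ c, D.nC e c x * D.UC e b c x) * pd d (D.ell2C e) x) / 2
      + (∑ c, D.nC e c x * D.nabla₂ e (D.YC e) d c b x
        - ∑ c, D.nC e c x * D.nabla₂ e (D.YC e) c d b x)
      + (D.YC e b d x * (2 * (∑ c, D.nC e c x * D.rC e c x - ∑ c, D.nC e c x * D.sC e c x)
          + D.n2C e x * ∑ c, D.nC e c x * pd c (D.ell2C e) x)
        - (∑ c, D.nC e c x * D.YC e b c x) *
          (2 * (D.rC e d x - D.sC e d x) + D.n2C e x * pd d (D.ell2C e) x)) / 2 := by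
    simp only [Finset.mul_sum, Finset.sum_mul, Finset.sum_div, ← Finset.sum_add_distrib,
      ← Finset.sum_sub_distrib]
    exact Finset.sum_congr rfl fun c _ => by rw [D.A_eq he hx]; ring
  rw [h, D.sum_nC_nabla_FC he hx, D.sum_nC_nabla_YC he hx, D.sum_nC_rC, D.sum_nC_sC, D.sum_nC_YC]
  simp only [vecD]
  ring

/-- The contraction `n^c (A_bcd + A_dcb)`. -/
theorem sum_nC_A_add_swap (he : e ∈ IsManifold.maximalAtlas (𝓡 m) ∞ N) (hx : x ∈ e.target)
    (b d : Fin m) :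
    ∑ c, D.nC e c x * (D.A e b c d x + D.A e d c b x)
      = -2 * lieD (D.nC e) (D.YC e) b d x
        + 2 * symPart (fun b d => D.nabla₁ e (fun a y => D.sC e a y + D.rC e a y) b d x) b d
        - 2 * D.κ e x * D.YC e b d x
        - 2 * (D.rC e b x - D.sC e b x) * (D.rC e d x - D.sC e d x)
        + symPart (fun b d =>
            (3 * D.n2C e x * D.sC e b x - 3 * D.n2C e x * D.rC e b x
              - 1 / 2 * pd b (D.n2C e) x
              - 1 / 2 * D.n2C e x ^ 2 * pd b (D.ell2C e) x) * pd d (D.ell2C e) x) b d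
        + (D.UC e b d x + D.n2C e x * D.YC e b d x) * vecD (D.nC e) (D.ell2C e) x
        + 2 * ∑ a, ∑ c, D.PC e a c x *
            symPart (fun b d => (D.YC e c b x - D.FC e c b x) *
              (D.UC e d a x - D.n2C e x * D.FC e d a x)) b d := by
  -- Writing the transport terms through £_n Y reverses the sign of the terms Y∇n, so that ∇n ends
  -- up contracted with Y - F; `covDVec_nC` then evaluates it.
  have hY : ∀ b d, ∑ c, D.YC e c b x * covDVec (D.Γ e) (D.nC e) d c x
      - ∑ c, D.FC e c b x * covDVec (D.Γ e) (D.nC e) d c x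
      = (D.rC e b x - D.sC e b x) * (D.sC e d x - D.n2C e x * pd d (D.ell2C e) x)
        + ∑ a, ∑ c, D.PC e a c x * ((D.YC e c b x - D.FC e c b x) *
              (D.UC e d a x - D.n2C e x * D.FC e d a x)) := fun b d => by
    rw [← Finset.sum_sub_distrib]
    simp only [← sub_mul]
    rw [D.sum_mul_covDVec_nC he hx]
    simp only [mul_sub, Finset.sum_sub_distrib, sub_mul]
    rfl
  have hsum : 2 * ∑ a, ∑ c, D.PC e a c x *
        symPart (fun b d => (D.YC e c b x - D.FC e c b x) *
          (D.UC e d a x - D.n2C e x * D.FC e d a x)) b d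
      = ∑ a, ∑ c, D.PC e a c x * ((D.YC e c b x - D.FC e c b x) *
              (D.UC e d a x - D.n2C e x * D.FC e d a x))
        + ∑ a, ∑ c, D.PC e a c x * ((D.YC e c d x - D.FC e c d x) *
              (D.UC e b a x - D.n2C e x * D.FC e b a x)) := by
    simp only [Finset.mul_sum, ← Finset.sum_add_distrib, symPart]
    exact Finset.sum_congr rfl fun a _ => Finset.sum_congr rfl fun c _ => by ring
  have hlie := lieD_eq_covD (v := D.nC e) (T := D.YC e)
    (fun c a b => D.Γ_symm (e := e) (x := x) c a b) b d
  have hYs : ∑ c, D.YC e b c x * covDVec (D.Γ e) (D.nC e) d c x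
      = ∑ c, D.YC e c b x * covDVec (D.Γ e) (D.nC e) d c x :=
    Finset.sum_congr rfl fun c _ => by rw [D.YC_symm b c]
  have hnY : ∑ c, D.nC e c x * D.nabla₂ e (D.YC e) c d b x
      = ∑ c, D.nC e c x * D.nabla₂ e (D.YC e) c b d x :=
    Finset.sum_congr rfl fun c _ => by
      rw [MetricHypersurfaceData.nabla₂, covD₂_symm D.YC_symm]; rfl
  have h1 := hY b d
  have h2 := hY d b
  rw [hYs] at hlie
  change _ = ∑ c, D.nC e c x * D.nabla₂ e (D.YC e) c b d x + _ + _ at hlie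
  simp only [mul_add (D.nC e _ x), Finset.sum_add_distrib]
  rw [D.sum_nC_A he hx, D.sum_nC_A he hx, hsum, hlie, D.sum_nC_UC he hx, D.sum_nC_UC he hx,
    hnY, D.YC_symm d b, D.UC_symm d b]
  simp only [symPart, D.nabla_sC_add_rC he hx]
  linear_combination h1 + h2

/-! ### The trace of B with P -/

theorem sum_PC_γC_riem (he : e ∈ IsManifold.maximalAtlas (𝓡 m) ∞ N) (hx : x ∈ e.target)
    (b d : Fin m) :
    ∑ a, ∑ c, D.PC e a c x * ∑ f, D.γC e a f x * D.riem e f b c d x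
      = D.ric e b d x - ∑ c, D.nC e c x * ∑ f, D.ellC e f x * D.riem e f b c d x := by
  have h : ∀ c, ∑ a, D.PC e a c x * ∑ f, D.γC e a f x * D.riem e f b c d x
      = D.riem e c b c d x - D.nC e c x * ∑ f, D.ellC e f x * D.riem e f b c d x := fun c => by
    have h1 : D.riem e c b c d x = ∑ f, (if c = f then 1 else 0) * D.riem e f b c d x := by simp
    rw [h1]
    simp only [Finset.mul_sum]
    rw [Finset.sum_comm, ← Finset.sum_sub_distrib]
    refine Finset.sum_congr rfl fun f _ => ?_
    -- Here δ^c_f = P^ca γ_af + n^c ℓ_f: the Kronecker delta yields the Ricci tensor after summation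
    -- over c.
    rw [← D.PC_γC he hx c f, add_mul, Finset.sum_mul, ← sub_eq_zero]
    have h2 : ∑ a, D.PC e a c x * (D.γC e a f x * D.riem e f b c d x)
        = ∑ a, D.PC e c a x * D.γC e a f x * D.riem e f b c d x :=
      Finset.sum_congr rfl fun a _ => by rw [D.PC_symm he hx a c]; ring
    rw [h2]
    ring
  rw [Finset.sum_comm]
  simp only [h, Finset.sum_sub_distrib]
  rfl

/-- The trace `P^ac B_abcd`. -/
theorem sum_PC_B (he : e ∈ IsManifold.maximalAtlas (𝓡 m) ∞ N) (hx : x ∈ e.target)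
    (b d : Fin m) :
    ∑ a, ∑ c, D.PC e a c x * D.B e a b c d x
      = symPart (fun b d => D.ric e b d x) b d
        - symPart (fun b d => D.nabla₁ e (D.sC e) b d x) b d
        + D.sC e b x * D.sC e d x
        - D.UC e b d x * vecD (D.nC e) (D.ell2C e) x
        + symPart (fun b d =>
            (-2 * D.n2C e x * D.sC e b x + 1 / 2 * pd b (D.n2C e) x
              + 1 / 2 * D.n2C e x ^ 2 * pd b (D.ell2C e) x) * pd d (D.ell2C e) x) b d
        + ∑ a, ∑ c, D.PC e a c x *
            (D.n2C e x * D.FC e b a x * D.FC e d c x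
              + D.UC e b a x * D.YC e d c x + D.UC e d a x * D.YC e b c x
              - D.UC e b d x * D.YC e a c x - D.YC e b d x * D.UC e a c x
              + D.n2C e x * D.YC e b a x * D.YC e d c x
              - D.n2C e x * D.YC e b d x * D.YC e a c x) := by
  -- The part of B that is algebraic in U, Y and F.
  set R : Fin m → Fin m → ℝ := fun a c =>
    (D.YC e b c x * D.UC e d a x - D.YC e b d x * D.UC e c a x)
      + (D.UC e b c x * (D.YC e d a x + D.FC e d a x)
        - D.UC e b d x * (D.YC e c a x + D.FC e c a x))
      + D.n2C e x * (D.YC e b c x * D.YC e d a x - D.YC e b d x * D.YC e c a x) with hR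
  have hℓ : ∑ a, ∑ c, D.PC e a c x * (D.ellC e a x *
        (D.nabla₂ e (D.UC e) d c b x - D.nabla₂ e (D.UC e) c d b x))
      = -∑ c, D.nC e c x * (D.ell2C e x *
        (D.nabla₂ e (D.UC e) d c b x - D.nabla₂ e (D.UC e) c d b x)) := by
    rw [Finset.sum_comm, ← Finset.sum_neg_distrib]
    refine Finset.sum_congr rfl fun c _ => ?_
    have h2 := D.PC_ellC he hx c
    have h3 : ∑ a, D.PC e a c x * (D.ellC e a x *
          (D.nabla₂ e (D.UC e) d c b x - D.nabla₂ e (D.UC e) c d b x))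
        = (∑ a, D.PC e c a x * D.ellC e a x) *
          (D.nabla₂ e (D.UC e) d c b x - D.nabla₂ e (D.UC e) c d b x) := by
      rw [Finset.sum_mul]
      exact Finset.sum_congr rfl fun a _ => by rw [D.PC_symm he hx a c]; ring
    rw [h3, eq_neg_of_add_eq_zero_left h2]
    ring
  have hB : ∑ a, ∑ c, D.PC e a c x * D.B e a b c d x
      = ∑ a, ∑ c, D.PC e a c x * ∑ f, D.γC e a f x * D.riem e f b c d x
        + ∑ a, ∑ c, D.PC e a c x * (D.ellC e a x *
          (D.nabla₂ e (D.UC e) d c b x - D.nabla₂ e (D.UC e) c d b x))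
        + ∑ a, ∑ c, D.PC e a c x * R a c := by
    simp only [← Finset.sum_add_distrib]
    exact Finset.sum_congr rfl fun a _ => Finset.sum_congr rfl fun c _ => by
      simp only [B, altPart, hR]; ring
  -- The derivatives of U produced by `hℓ` are those contained in n^c ℓ_f R^f_bcd with the opposite
  -- sign, so no ∇U remains.
  have hn : ∑ c, D.nC e c x * ∑ f, D.ellC e f x * D.riem e f b c d x
        + ∑ c, D.nC e c x * (D.ell2C e x *
          (D.nabla₂ e (D.UC e) d c b x - D.nabla₂ e (D.UC e) c d b x))
      = ∑ c, D.nC e c x * D.nabla₂ e (D.FC e) b c d x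
        + D.UC e b d x * vecD (D.nC e) (D.ell2C e) x
        - (∑ c, D.nC e c x * D.UC e b c x) * pd d (D.ell2C e) x := by
    simp only [vecD, Finset.mul_sum (a := D.UC e b d x), Finset.sum_mul, ← Finset.sum_add_distrib,
      ← Finset.sum_sub_distrib]
    exact Finset.sum_congr rfl fun c _ => by
      rw [D.ellC_riem he hx, D.UC_symm d b, D.UC_symm c b]; ring
  -- The first sum comes from F_cd ∇_b n^c. The mixed products of U and F cancel only after
  -- symmetrization in a, c, and F_ca is traceless by antisymmetry.
  have hP : ∑ a, ∑ c, D.PC e a c x *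
        (D.FC e c d x * (D.UC e b a x - D.n2C e x * D.FC e b a x))
      + ∑ a, ∑ c, D.PC e a c x * R a c = ∑ a, ∑ c, D.PC e a c x *
            (D.n2C e x * D.FC e b a x * D.FC e d c x
              + D.UC e b a x * D.YC e d c x + D.UC e d a x * D.YC e b c x
              - D.UC e b d x * D.YC e a c x - D.YC e b d x * D.UC e a c x
              + D.n2C e x * D.YC e b a x * D.YC e d c x
              - D.n2C e x * D.YC e b d x * D.YC e a c x) := by
    simp only [← Finset.sum_add_distrib, ← mul_add]
    refine D.sum_PC_congr he hx fun a c => ?_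
    simp only [hR, D.FC_antisymm c d x, D.FC_antisymm a d x, D.FC_antisymm c a x,
      D.YC_symm c a x, D.UC_symm c a x]
    ring
  have hFN := D.sum_mul_covDVec_nC he hx (fun c => D.FC e c d x) b
  change _ = D.sC e d x * _ + _ at hFN
  have hric := D.ric_sub_swap he hx b d
  have hnab := covD₁_sub_swap (θ := D.sC e) (fun c a b => D.Γ_symm (e := e) (x := x) c a b) b d
  change D.nabla₁ e (D.sC e) b d x - D.nabla₁ e (D.sC e) d b x = _ at hnab
  have hF := D.sum_nC_nabla_FC he hx b d
  have hU := D.sum_nC_UC he hx b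
  rw [hB, hℓ, D.sum_PC_γC_riem he hx, ← hP]
  rw [hF, hFN, hU] at hn
  simp only [symPart]
  -- What has been computed contains R_bd - ∇_b s_d + (1/2) ∂_b n₂ ∂_d ℓ₂. By `ric_sub_swap` its
  -- antisymmetric part is zero, so each term may be symmetrized.
  linear_combination (hric - hnab) / 2 - hn

end HypersurfaceData

/-! ### The constraint tensor -/

/-- The sum of the two contractions is the constraint tensor. -/
theorem HypersurfaceData.sum_nC_A_add_sum_PC_B {m : ℕ} {N : Type*} [TopologicalSpace N]
    [ChartedSpace (EuclideanSpace ℝ (Fin m)) N] [IsManifold (𝓡 m) ∞ N]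
    (D : HypersurfaceData m N)
    {e : OpenPartialHomeomorph N (EuclideanSpace ℝ (Fin m))}
    (he : e ∈ IsManifold.maximalAtlas (𝓡 m) ∞ N)
    {x : EuclideanSpace ℝ (Fin m)} (hx : x ∈ e.target) (b d : Fin m) :
    ∑ c, D.nC e c x * (D.A e b c d x + D.A e d c b x)
      + ∑ a, ∑ c, D.PC e a c x * D.B e a b c d x = D.constraintTensor e b d x := by
  -- All terms contracted with P, including the two traces, are gathered under one sum; the summands
  -- agree only after symmetrization in a, c.
  have hP : ∑ a, ∑ c, D.PC e a c x *
          (D.n2C e x * D.FC e b a x * D.FC e d c x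
            + D.UC e b a x * D.YC e d c x + D.UC e d a x * D.YC e b c x
            - D.UC e b d x * D.YC e a c x - D.YC e b d x * D.UC e a c x
            + D.n2C e x * D.YC e b a x * D.YC e d c x
            - D.n2C e x * D.YC e b d x * D.YC e a c x)
        + 2 * ∑ a, ∑ c, D.PC e a c x *
            symPart (fun b d => (D.YC e c b x - D.FC e c b x) *
              (D.UC e d a x - D.n2C e x * D.FC e d a x)) b d
      = 2 * ∑ a, ∑ c, D.PC e a c x *
          symPart (fun b d => D.UC e a b x * (2 * D.YC e d c x + D.FC e d c x)) b d
        + D.n2C e x * ∑ a, ∑ c, D.PC e a c x *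
            ((D.YC e a b x + D.FC e a b x) * (D.YC e c d x + D.FC e c d x)
              - 2 * D.FC e a b x * D.FC e c d x)
        - D.YC e b d x * ∑ a, ∑ c, D.PC e a c x * D.UC e a c x
        - (D.UC e b d x + D.n2C e x * D.YC e b d x) *
          ∑ a, ∑ c, D.PC e a c x * D.YC e a c x := by
    simp only [Finset.mul_sum, mul_left_comm _ (D.PC e _ _ x), ← Finset.sum_add_distrib,
      ← Finset.sum_sub_distrib, ← mul_add, ← mul_sub]
    refine D.sum_PC_congr he hx fun a c => ?_
    simp only [symPart, D.FC_antisymm c d x, D.FC_antisymm a d x, D.FC_antisymm c b x,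
      D.FC_antisymm a b x, D.YC_symm c d x, D.YC_symm a d x, D.YC_symm c b x,
      D.YC_symm a b x, D.YC_symm c a x, D.UC_symm c d x, D.UC_symm a d x, D.UC_symm c b x,
      D.UC_symm a b x, D.UC_symm c a x]
    ring
  rw [D.sum_nC_A_add_swap he hx, D.sum_PC_B he hx]
  simp only [HypersurfaceData.constraintTensor, MetricHypersurfaceData.trP,
    D.nabla_sC_add_two_rC he hx, D.nabla_sC_add_rC he hx]
  simp only [symPart] at hP ⊢
  linear_combination hP

theorem proposition4p2 {m : ℕ} {N : Type*} [TopologicalSpace N]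
    [ChartedSpace (EuclideanSpace ℝ (Fin m)) N] [IsManifold (𝓡 m) ∞ N]
    (D : HypersurfaceData m N)
    (e : OpenPartialHomeomorph N (EuclideanSpace ℝ (Fin m)))
    (he : e ∈ IsManifold.maximalAtlas (𝓡 m) ∞ N)
    (x : EuclideanSpace ℝ (Fin m)) (hx : x ∈ e.target) (b d : Fin m) :
    -- the trace `P^ac B_abcd`
    (∑ a, ∑ c, D.PC e a c x * D.B e a b c d x
      = symPart (fun b d => D.ric e b d x) b d
        - symPart (fun b d => D.nabla₁ e (D.sC e) b d x) b d
        + D.sC e b x * D.sC e d x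
        - D.UC e b d x * vecD (D.nC e) (D.ell2C e) x
        + symPart (fun b d =>
            (-2 * D.n2C e x * D.sC e b x + 1 / 2 * pd b (D.n2C e) x
              + 1 / 2 * D.n2C e x ^ 2 * pd b (D.ell2C e) x) * pd d (D.ell2C e) x) b d
        + ∑ a, ∑ c, D.PC e a c x *
            (D.n2C e x * D.FC e b a x * D.FC e d c x
              + D.UC e b a x * D.YC e d c x + D.UC e d a x * D.YC e b c x
              - D.UC e b d x * D.YC e a c x - D.YC e b d x * D.UC e a c x
              + D.n2C e x * D.YC e b a x * D.YC e d c x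
              - D.n2C e x * D.YC e b d x * D.YC e a c x)) ∧
    -- the contraction `n^c (A_bcd + A_dcb)`
    (∑ c, D.nC e c x * (D.A e b c d x + D.A e d c b x)
      = -2 * lieD (D.nC e) (D.YC e) b d x
        + 2 * symPart (fun b d => D.nabla₁ e (fun a y => D.sC e a y + D.rC e a y) b d x) b d
        - 2 * D.κ e x * D.YC e b d x
        - 2 * (D.rC e b x - D.sC e b x) * (D.rC e d x - D.sC e d x)
        + symPart (fun b d =>
            (3 * D.n2C e x * D.sC e b x - 3 * D.n2C e x * D.rC e b x
              - 1 / 2 * pd b (D.n2C e) x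
              - 1 / 2 * D.n2C e x ^ 2 * pd b (D.ell2C e) x) * pd d (D.ell2C e) x) b d
        + (D.UC e b d x + D.n2C e x * D.YC e b d x) * vecD (D.nC e) (D.ell2C e) x
        + 2 * ∑ a, ∑ c, D.PC e a c x *
            symPart (fun b d => (D.YC e c b x - D.FC e c b x) *
              (D.UC e d a x - D.n2C e x * D.FC e d a x)) b d) ∧
    -- their sum
    (∑ c, D.nC e c x * (D.A e b c d x + D.A e d c b x)
        + ∑ a, ∑ c, D.PC e a c x * D.B e a b c d x
      = symPart (fun b d => D.ric e b d x) b d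
        - 2 * lieD (D.nC e) (D.YC e) b d x
        - (2 * D.κ e x + D.trP e (D.UC e) x
            - D.n2C e x * (vecD (D.nC e) (D.ell2C e) x - D.trP e (D.YC e) x)) * D.YC e b d x
        + symPart (fun b d => D.nabla₁ e (fun a y => D.sC e a y + 2 * D.rC e a y) b d x) b d
        - 2 * D.rC e b x * D.rC e d x
        + 4 * symPart (fun b d => D.rC e b x * D.sC e d x) b d
        - D.sC e b x * D.sC e d x
        - D.trP e (D.YC e) x * D.UC e b d x
        + 2 * ∑ a, ∑ c, D.PC e a c x *
            symPart (fun b d => D.UC e a b x * (2 * D.YC e d c x + D.FC e d c x)) b d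
        + D.n2C e x *
            (symPart (fun b d => (D.sC e b x - 3 * D.rC e b x) * pd d (D.ell2C e) x) b d
              + ∑ a, ∑ c, D.PC e a c x *
                  ((D.YC e a b x + D.FC e a b x) * (D.YC e c d x + D.FC e c d x)
                    - 2 * D.FC e a b x * D.FC e c d x))) ∧
    -- the sum is the constraint tensor
    ∑ c, D.nC e c x * (D.A e b c d x + D.A e d c b x)
        + ∑ a, ∑ c, D.PC e a c x * D.B e a b c d x
      = D.constraintTensor e b d x := by
  have h := D.sum_nC_A_add_sum_PC_B he hx b d
  -- The last two conjuncts differ only by unfolding `constraintTensor`, so `h` serves for both.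
  exact ⟨D.sum_PC_B he hx b d, D.sum_nC_A_add_swap he hx b d, h, h⟩
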